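/- Let $\Sigma$ be a finite alphabet, let $\overline\Sigma=\{\overline a : a\in\Sigma\}$ be a disjoint copy of it, and for a finite set $P$ of strings over $\Sigma$ put $f(P)=P\cup\overline P$, where $\overline P=\{\overline w : w\in P\}$ and $\overline{a_1\cdots a_k}=\overline{a_1}\cdots\overline{a_k}$. A linear superstring of $P$ is a string that has every string of $P$ as a substring; a circular superstring of $P$ is a circular string $\langle w\rangle$ such that every string of $P$ is a substring of $www\cdots$. In SLS (resp. SCS) the solutions for $P$ are the linear (resp. circular) superstrings $y$ of $P$; under the length measure the cost $|y|$ is minimized, under the compression measure the cost $\|P\|-|y|$, where $\|P\|=\sum_{w\in P}|w|$, is maximized. Let $ov(x,y)$ be the length of the longest string that is a proper suffix of $x$ and a proper prefix of $y$ (and $0$ if there is none), and let the merge of $x$ and $y$ be $x$ followed by $y$ without its first $ov(x,y)$ letters. A greedy linear superstring of $P$ is a string that results from $P$ by repeatedly replacing two different strings $u,v$ of the current set with $ov(u,v)$ maximal by their merge, ties being broken arbitrarily, until one string is left. A greedy circular superstring of $P$ is obtained from a greedy linear superstring $w$ of $P$ by merging $w$ with itself, i.e. it is the circular string formed by $w$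 without its first $ov(w,w)$ letters. For a solution of cost $c$ of an instance with optimal cost $o$ let the performance ratio be $R=\max(o/c,\,c/o)$ if $o,c>0$; otherwise let $R=1$ if $c=o$ and $R=\infty$ if $c\neq o$. **Theorem.** There is a function $g$ from circular strings over $\Sigma\cup\overline\Sigma$ to strings over $\Sigma$ such that $f$ and $g$ are computable in polynomial time and, for both the length and the compression measure, $(f,g)$ is a Strict-reduction from SLS to SCS: for every finite set $P$ of strings over $\Sigma$ and every circular superstring $c$ of $P\cup\overline P$, $g(c)$ is a linear superstring of $P$, and the performance ratio of $g(c)$ for $P$ is at most that of $c$ for $P\cup\overline P$. Moreover $|g(c)|\le |c|/2$, and a shortest circular superstring of $P\cup\overline P$ has exactly twice the length of a shortest linear superstring of $P$. On the instances $P$ in which no string is a substring of another string of $P$ (which makes $P\cup\overline P$ an instance of the same kind), $(f,g)$ is a Greedy-reduction for both measures: in addition, if $c$ is a greedy circular superstring of $P\cup\overline P$, then $g(c)$ is a greedy linear superstring of $P$. -/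

import Mathlib

open scoped ENNReal

namespace CircularSuperstring

/-! ## Strings, overlaps, merges -/

/-- `s` is an overlap from `x` to `y`: a proper suffix of `x` that is also a proper prefix
of `y`. -/
def IsOverlap {β : Type} (s x y : List β) : Prop :=
  s <:+ x ∧ s ≠ x ∧ s <+: y ∧ s ≠ y

/-- The length of the longest overlap from `x` to `y` (a supremum of a bounded set of natural
numbers; it is `0` if the only overlap is the empty one, or if there is none at all because
`x` or `y` is empty). -/
noncomputable def ov {β : Type} (x y : List β) : ℕ :=
  sSup {n | ∃ s, IsOverlap s x y ∧ s.length = n}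

/-- The merge from `x` to `y`: `x` followed by `y` without its first `ov x y` letters. -/
noncomputable def merge {β : Type} (x y : List β) : List β :=
  x ++ y.drop (ov x y)

/-- `x` is a substring of the circular string `c = ⟨w⟩`: a finite substring of the infinite
repetition `www…` (equivalently, of some finite power of `w`). -/
def IsCircularSubstring {β : Type} (x : List β) (c : Cycle β) : Prop :=
  ∃ w : List β, (w : Cycle β) = c ∧ ∃ n : ℕ, x <:+: (List.replicate n w).flatten

/-- `w` is a linear superstring of `P`. -/
def IsLinearSuperstring {β : Type} (P : Finset (List β)) (w : List β) : Prop :=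
  ∀ x ∈ P, x <:+: w

/-- `c` is a circular superstring of `P`. -/
def IsCircularSuperstring {β : Type} (P : Finset (List β)) (c : Cycle β) : Prop :=
  ∀ x ∈ P, IsCircularSubstring x c

/-- No string of `P` is a substring of another string of `P`. -/
def SubstringFree {β : Type} (P : Finset (List β)) : Prop :=
  ∀ x ∈ P, ∀ y ∈ P, x <:+: y → x = y

/-- The sum `‖P‖` of the lengths of the strings of `P`. -/
def totalLength {β : Type} (P : Finset (List β)) : ℕ :=
  ∑ w ∈ P, w.length

/-! ## The greedy algorithms -/

/-- One step of the greedy algorithm: two different strings `u`, `v` of the current set such that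
`ov u v` is maximal are removed, and their merge is inserted. -/
def GreedyStep {β : Type} [DecidableEq β] (Q Q' : Finset (List β)) : Prop :=
  ∃ u ∈ Q, ∃ v ∈ Q, u ≠ v ∧
    (∀ u' ∈ Q, ∀ v' ∈ Q, u' ≠ v' → ov u' v' ≤ ov u v) ∧
    Q' = insert (merge u v) ((Q.erase u).erase v)

/-- `w` is a greedy linear superstring of `P`: some run of the greedy algorithm (ties may be broken
in any way) that starts with `P` ends with the single string `w`. -/
def IsGreedyLinear {β : Type} [DecidableEq β] (P : Finset (List β)) (w : List β) : Prop :=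
  Relation.ReflTransGen GreedyStep P {w}

/-- `c` is a greedy circular superstring of `P`: the circular string obtained by merging a greedy
linear superstring of `P` with itself. -/
def IsGreedyCircular {β : Type} [DecidableEq β] (P : Finset (List β)) (c : Cycle β) : Prop :=
  ∃ w, IsGreedyLinear P w ∧ c = (w.drop (ov w w) : List β)

/-! ## Polynomial-time computable functions -/

/-- `h` is computable in polynomial time, when `ρ w x` (resp. `ρ' w y`) says that the word `w` is
a code of the object `x` (resp. `y`): there is a (multi-stack) Turing machine that runs in time
polynomial in the length of its input, and that turns every code of every `x` into a code of
`h x`. Objects may have several codes. -/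
def PolyTimeComputable {X Y Γ Γ' : Type} (ρ : List Γ → X → Prop) (ρ' : List Γ' → Y → Prop)
    (h : X → Y) : Prop :=
  ∃ F : {w : List Γ // ∃ x, ρ w x} → List Γ',
    Nonempty (Turing.TM2ComputableInPolyTime
      (fun w : {w : List Γ // ∃ x, ρ w x} => w.1) (fun v : List Γ' => v) F) ∧
    ∀ (w : {w : List Γ // ∃ x, ρ w x}) (x : X), ρ w.1 x → ρ' (F w) (h x)

/-- The code of a finite sequence of words; `none` marks the end of each word. -/
def encodeWords {β : Type} (l : List (List β)) : List (Option β) :=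
  l.flatMap fun w => w.map some ++ [none]

/-- A finite set of words is coded by any listing of its elements without repetition. -/
def CodesSet {β : Type} (w : List (Option β)) (P : Finset (List β)) : Prop :=
  ∃ l : List (List β), (l : Multiset (List β)) = P.val ∧ w = encodeWords l

/-- A linear string is its own code. -/
def CodesString {β : Type} (w : List β) (x : List β) : Prop :=
  w = x

/-- The circular string `⟨w⟩` is coded by `w` (and by every rotation of `w`). -/
def CodesCircular {β : Type} (w : List β) (c : Cycle β) : Prop :=
  (w : Cycle β) = c

/-! ## Optimization problems and reductions -/

/-- An optimization problem, together with the notion of greedy solution that belongs to it and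
with the coding of its instances and solutions by words. -/
structure OptimizationProblem where
  /-- the objects among which the instances are -/
  Inst : Type
  /-- the objects among which the solutions are -/
  Sol : Type
  /-- the instances -/
  IsInstance : Inst → Prop
  /-- the (feasible) solutions of an instance -/
  IsSolution : Inst → Sol → Prop
  /-- the cost of a solution -/
  cost : Inst → Sol → ℤ
  /-- whether the cost is to be maximized (otherwise it is to be minimized) -/
  maximize : Bool
  /-- the greedy solutions of an instance -/
  IsGreedy : Inst → Sol → Prop
  /-- the alphabet in which instances are written -/
  InstSymbol : Type
  /-- the alphabet in which solutions are written -/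
  SolSymbol : Type
  /-- the codes of instances -/
  codesInst : List InstSymbol → Inst → Prop
  /-- the codes of solutions -/
  codesSol : List SolSymbol → Sol → Prop

/-- `y` is an optimal solution of `x`. -/
def OptimizationProblem.IsOptimal (A : OptimizationProblem) (x : A.Inst) (y : A.Sol) : Prop :=
  A.IsSolution x y ∧ ∀ z, A.IsSolution x z →
    if A.maximize = true then A.cost x z ≤ A.cost x y else A.cost x y ≤ A.cost x z

/-- The same problem, on the instances in `S` only. -/
def OptimizationProblem.restrict (A : OptimizationProblem) (S : A.Inst → Prop) :
    OptimizationProblem :=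
  { A with IsInstance := fun x => A.IsInstance x ∧ S x }

/-- The performance ratio `max (opt / c) (c / opt)` of a solution of cost `c`, if the optimal cost
is `opt`. The quotients make sense for positive costs only; otherwise the ratio is `1` for an
optimal solution and infinite for any other one. -/
noncomputable def performanceRatio (opt c : ℤ) : ℝ≥0∞ :=
  if c = opt then 1
  else if 0 < opt ∧ 0 < c then ENNReal.ofReal (max ((opt : ℝ) / c) ((c : ℝ) / opt))
  else ⊤

/-- `(f, g)` is a Strict-reduction from `A` to `B`. -/
structure IsStrictReduction (A B : OptimizationProblem) (f : A.Inst → B.Inst)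
    (g : B.Sol → A.Sol) : Prop where
  polyTime_f : PolyTimeComputable (fun w x => A.codesInst w x ∧ A.IsInstance x) B.codesInst f
  polyTime_g : PolyTimeComputable B.codesSol A.codesSol g
  instances : ∀ x, A.IsInstance x → B.IsInstance (f x)
  solutions : ∀ x, A.IsInstance x → ∀ y, B.IsSolution (f x) y → A.IsSolution x (g y)
  ratio : ∀ x, A.IsInstance x → ∀ y, B.IsSolution (f x) y →
    ∀ optA, A.IsOptimal x optA → ∀ optB, B.IsOptimal (f x) optB →
      performanceRatio (A.cost x optA) (A.cost x (g y)) ≤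
        performanceRatio (B.cost (f x) optB) (B.cost (f x) y)

/-- `(f, g)` is a Greedy-reduction from `A` to `B`: a Strict-reduction that sends greedy solutions
to greedy solutions. -/
structure IsGreedyReduction (A B : OptimizationProblem) (f : A.Inst → B.Inst)
    (g : B.Sol → A.Sol) : Prop extends IsStrictReduction A B f g where
  greedy : ∀ x, A.IsInstance x → ∀ y, B.IsGreedy (f x) y → A.IsGreedy x (g y)

/-! ## The two superstring problems -/

/-- The two measures: the length of a superstring (to be minimized), and its compression
(to be maximized). -/
inductive Objective
  | length
  | compression

/-- The cost of a superstring of `P` of length `n`: `n` for the length measure, and `‖P‖ - n` for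
the compression measure. -/
def objectiveCost {β : Type} : Objective → Finset (List β) → ℕ → ℤ
  | .length, _, n => n
  | .compression, P, n => (totalLength P : ℤ) - n

/-- Only the compression is maximized. -/
def Objective.isMax : Objective → Bool
  | .length => false
  | .compression => true

/-- Shortest Linear Superstring over the alphabet `β`, for one of the two measures. -/
def SLS (β : Type) [DecidableEq β] (m : Objective) : OptimizationProblem where
  Inst := Finset (List β)
  Sol := List β
  IsInstance _ := True
  IsSolution := IsLinearSuperstring
  cost P w := objectiveCost m P w.length
  maximize := m.isMax
  IsGreedy := IsGreedyLinear
  InstSymbol := Option β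
  SolSymbol := β
  codesInst := CodesSet
  codesSol := CodesString

/-- Shortest Circular Superstring over the alphabet `β`, for one of the two measures. -/
def SCS (β : Type) [DecidableEq β] (m : Objective) : OptimizationProblem where
  Inst := Finset (List β)
  Sol := Cycle β
  IsInstance _ := True
  IsSolution := IsCircularSuperstring
  cost P c := objectiveCost m P c.length
  maximize := m.isMax
  IsGreedy := IsGreedyCircular
  InstSymbol := Option β
  SolSymbol := β
  codesInst := CodesSet
  codesSol := CodesCircular

/-- The set `P ∪ P̄` over the alphabet `α ⊕ α`, in which the letter `a` is `Sum.inl a`, and the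
barred letter `ā` is `Sum.inr a`. -/
def withBarred {α : Type} [DecidableEq α] (P : Finset (List α)) : Finset (List (α ⊕ α)) :=
  P.image (List.map Sum.inl) ∪ P.image (List.map Sum.inr)

end CircularSuperstring

open CircularSuperstring

/-! No string of `P ∪ P̄` mixes barred and unbarred letters. If `P` has a nonempty string, a
circular superstring `c` contains letters of both kinds, so it can be cut open into a string `u`
that begins with an unbarred letter and ends with a barred one. An occurrence of a string of `P ∪
P̄` in `uuu…` cannot cross a seam between two copies of `u`, since it would contain letters of both
kinds. Hence the unbarred letters of `u` form a linear superstring of `P`, and so do the barred ones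
without their bars; the shorter of the two has length at most `|c|/2` and is taken as `g(c)`
(`halve`, `isLinearSuperstring_halve`). Conversely, if `w` is a linear superstring of `P`, then `⟨w
w̄⟩` is a circular superstring of `P ∪ P̄`. So the optimal length exactly doubles
(`length_of_isOptimal`), and as `‖P ∪ P̄‖ = 2‖P‖`, neither ratio can grow
(`performanceRatio_halve_le`).

To make `g` independent of the representative, `c` is cut at its least rotation, where bar patterns
are compared first, as binary numbers, and letters afterwards. A least bar pattern starts with an
unbarred letter and ends with a barred one (`startsAtBlock_canonicalRotation`).

For greedy solutions, let no string of `P` contain another, and leave aside `P = {[]}`. Overlaps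
between barred and unbarred strings are empty. As long as the maximal overlap is positive, each
greedy step on `P ∪ P̄` is therefore a greedy step on one of the two halves. Once it is zero it
stays zero, and the rest of the run, including the final self-merge, just concatenates the remaining
strings (`exists_of_greedy_mixed`). The cut falls between two of these, so each part of `u`
concatenates the remaining strings of its half in some order, and every order is a possible greedy
outcome (`greedy_parts`).

Polynomial time is shown by explicit stack machines for `withBarred` and `halve`, with step counts.
-/

namespace CircularSuperstring

/-! ## Overlaps -/

section Overlaps

variable {β γ : Type}

theorem bddAbove_overlap (x y : List β) : BddAbove {n | ∃ s, IsOverlap s x y ∧ s.length = n} :=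
  ⟨x.length, by rintro n ⟨s, hs, rfl⟩; exact hs.1.length_le⟩

theorem IsOverlap.length_le_ov {s x y : List β} (h : IsOverlap s x y) : s.length ≤ ov x y :=
  le_csSup (bddAbove_overlap x y) ⟨s, h, rfl⟩

theorem exists_isOverlap {x y : List β} (hx : x ≠ []) (hy : y ≠ []) :
    ∃ s, IsOverlap s x y ∧ s.length = ov x y :=
  Nat.sSup_mem (s := {n | ∃ s, IsOverlap s x y ∧ s.length = n})
    ⟨0, [], ⟨List.nil_suffix, hx.symm, List.nil_prefix, hy.symm⟩, rfl⟩ (bddAbove_overlap x y)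

theorem ov_le {x y : List β} {k : ℕ} (h : ∀ s, IsOverlap s x y → s.length ≤ k) : ov x y ≤ k :=
  csSup_le' (by rintro n ⟨s, hs, rfl⟩; exact h s hs)

theorem isOverlap_map_iff {f : β → γ} (hf : Function.Injective f) {x y : List β} {s : List γ} :
    IsOverlap s (x.map f) (y.map f) ↔ ∃ t, s = t.map f ∧ IsOverlap t x y := by
  have inj := List.map_injective_iff.2 hf
  constructor
  · rintro ⟨⟨a, ha⟩, h2, ⟨b, hb⟩, h4⟩
    obtain ⟨a', t, rfl, rfl, rfl⟩ := List.map_eq_append_iff.1 ha.symm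
    refine ⟨t, rfl, ⟨a', rfl⟩, fun h => h2 (congrArg _ h), ?_, fun h => h4 (congrArg _ h)⟩
    obtain ⟨t', b', h, h', rfl⟩ := List.map_eq_append_iff.1 hb.symm
    exact ⟨b', by rw [h, inj h']⟩
  · rintro ⟨t, rfl, h1, h2, h3, h4⟩
    exact ⟨h1.map f, fun h => h2 (inj h), h3.map f, fun h => h4 (inj h)⟩

theorem ov_map {f : β → γ} (hf : Function.Injective f) (x y : List β) :
    ov (x.map f) (y.map f) = ov x y := by
  refine le_antisymm (ov_le fun s hs => ?_) (ov_le fun s hs => ?_)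
  · obtain ⟨t, rfl, ht⟩ := (isOverlap_map_iff hf).1 hs
    simpa using ht.length_le_ov
  · simpa using ((isOverlap_map_iff hf).2 ⟨s, rfl, hs⟩).length_le_ov

theorem merge_map {f : β → γ} (hf : Function.Injective f) (x y : List β) :
    merge (x.map f) (y.map f) = (merge x y).map f := by
  simp [merge, ov_map hf]

theorem merge_of_ov_eq_zero {x y : List β} (h : ov x y = 0) : merge x y = x ++ y := by
  simp [merge, h]

theorem prefix_merge (x y : List β) : x <+: merge x y :=
  List.prefix_append _ _

/-- A longest overlap splits both strings. -/
theorem exists_split_of_overlap {u v : List β} (hu : u ≠ []) (hv : v ≠ []) :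
    ∃ a s b, u = a ++ s ∧ v = s ++ b ∧ s.length = ov u v ∧ a ≠ [] ∧ b ≠ [] ∧
      merge u v = u ++ b ∧ merge u v = a ++ v := by
  obtain ⟨s, ⟨⟨a, rfl⟩, h2, ⟨b, rfl⟩, h4⟩, hs⟩ := exists_isOverlap hu hv
  have hm : merge (a ++ s) (s ++ b) = (a ++ s) ++ b := by
    rw [merge, ← hs, List.drop_left]
  refine ⟨a, s, b, rfl, rfl, hs, ?_, ?_, hm, by simp [hm]⟩
  · rintro rfl; simp at h2
  · rintro rfl; simp at h4

theorem suffix_merge {u v : List β} (hu : u ≠ []) (hv : v ≠ []) : v <:+ merge u v := by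
  obtain ⟨a, s, b, -, -, -, -, -, -, h⟩ := exists_split_of_overlap hu hv
  exact ⟨a, h.symm⟩

/-- This is what keeps greedy sets substring-free. An occurrence of `x` that fits into neither `u`
nor `v` starts in `u` before the overlap and ends after `u`. Its portion in `u` is then all of `u`,
or an overlap from `u` to `x` that exceeds `ov u v`. -/
theorem infix_of_infix_merge {u v x : List β} (hu : u ≠ []) (hv : v ≠ [])
    (hx : x <:+: merge u v) :
    x <:+: u ∨ x <:+: v ∨ u <:+: x ∨ ov u v < ov u x := by
  obtain ⟨a, s, b, h1, h2, h3, -, -, hm, -⟩ := exists_split_of_overlap hu hv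
  rw [hm, List.infix_append_iff] at hx
  rcases hx with hx | hx | ⟨p, q, rfl, hp, hq⟩
  · exact Or.inl hx
  · exact Or.inr (Or.inl (hx.trans ⟨s, [], by simp [h2]⟩))
  · by_cases hps : p.length ≤ s.length
    · obtain ⟨r, hr⟩ := List.suffix_of_suffix_length_le hp ⟨a, h1.symm⟩ hps
      obtain ⟨t, ht⟩ := hq
      exact Or.inr (Or.inl ⟨r, t, by rw [h2, ← hr, ← ht]; simp⟩)
    · by_cases hq0 : q = []
      · subst hq0; simpa using Or.inl hp.isInfix
      by_cases hpu : p = u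
      · subst hpu; exact Or.inr (Or.inr (Or.inl (List.prefix_append _ _).isInfix))
      · have : IsOverlap p u (p ++ q) := ⟨hp, hpu, List.prefix_append _ _, by simpa using hq0⟩
        have := this.length_le_ov
        exact Or.inr (Or.inr (Or.inr (by omega)))

/-- An overlap at least as long as `v` would contain `v` and so place it inside `y`; a shorter one
is already an overlap from `v`. -/
theorem ov_merge_left_le {u v y : List β} (hu : u ≠ []) (hv : v ≠ []) (h : ¬ v <:+: y) :
    ov (merge u v) y ≤ ov v y := by
  refine ov_le fun s ⟨h1, h2, h3, h4⟩ => ?_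
  rcases le_or_gt v.length s.length with hl | hl
  · exact absurd ((List.suffix_of_suffix_length_le (suffix_merge hu hv) h1 hl).isInfix.trans
      h3.isInfix) h
  · refine IsOverlap.length_le_ov
      ⟨List.suffix_of_suffix_length_le h1 (suffix_merge hu hv) hl.le, ?_, h3, h4⟩
    rintro rfl; exact lt_irrefl _ hl

theorem ov_merge_right_le {u v y : List β} (h : ¬ u <:+: y) :
    ov y (merge u v) ≤ ov y u := by
  refine ov_le fun s ⟨h1, h2, h3, h4⟩ => ?_
  rcases le_or_gt u.length s.length with hl | hl
  · exact absurd ((List.prefix_of_prefix_length_le (prefix_merge u v) h3 hl).isInfix.trans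
      h1.isInfix) h
  · refine IsOverlap.length_le_ov
      ⟨h1, h2, List.prefix_of_prefix_length_le h3 (prefix_merge u v) hl.le, ?_⟩
    rintro rfl; exact lt_irrefl _ hl

/-- Needed for closing the circle: if all overlaps vanish before the last merge, the resulting
string has no self-overlap either. -/
theorem ov_merge_self_le {u v : List β} (hu : u ≠ []) (hv : v ≠ []) (huv : ¬ u <:+: v)
    (hvu : ¬ v <:+: u) : ov (merge u v) (merge u v) ≤ ov v u := by
  obtain ⟨a, o, b, ha, hb, ho, -, -, hm, -⟩ := exists_split_of_overlap hu hv
  refine ov_le fun s ⟨h1, _, h3, h4⟩ => ?_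
  rcases le_or_gt v.length s.length with hl | hl
  · exfalso
    have hvs := List.suffix_of_suffix_length_le (suffix_merge hu hv) h1 hl
    rcases le_or_gt s.length u.length with hl' | hl'
    · exact hvu (hvs.isInfix.trans
        (List.prefix_of_prefix_length_le h3 (prefix_merge u v) hl').isInfix)
    -- Here `s = u ++ q` ends in `v`. Writing `v = p ++ q` makes `p` an overlap from `u` to `v`. As
    -- `q` is shorter than `b`, `p` is longer than the longest overlap `o`.
    obtain ⟨q, rfl⟩ := List.prefix_of_prefix_length_le (prefix_merge u v) h3 hl'.le
    have hq : q.length < b.length := by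
      have h5 := h3.length_le
      have h6 : (u ++ q).length ≠ (merge u v).length := fun h => h4 (h3.eq_of_length h)
      rw [hm] at h5 h6
      simp only [List.length_append] at h5 h6
      omega
    have hvl : v.length = o.length + b.length := by rw [hb]; simp
    have hqv : q <:+ v := List.suffix_of_suffix_length_le (List.suffix_append u q) hvs (by omega)
    obtain ⟨p, hp⟩ := hqv
    have hpu : p <:+ u := by
      obtain ⟨r, hr⟩ := hvs
      rw [← hp, ← List.append_assoc] at hr
      exact ⟨r, List.append_cancel_right hr⟩
    have hpl : p.length + q.length = v.length := by rw [← hp]; simp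
    have hov : IsOverlap p u v := by
      refine ⟨hpu, ?_, ⟨q, hp⟩, ?_⟩
      · rintro rfl; exact huv ⟨[], q, by simpa using hp⟩
      · rintro rfl; exact hvu hpu.isInfix
    have := hov.length_le_ov
    omega
  · have hsv := List.suffix_of_suffix_length_le h1 (suffix_merge hu hv) hl.le
    rcases le_or_gt u.length s.length with hl' | hl'
    · exact absurd ((List.prefix_of_prefix_length_le (prefix_merge u v) h3 hl').isInfix.trans
        hsv.isInfix) huv
    · refine IsOverlap.length_le_ov
        ⟨hsv, ?_, List.prefix_of_prefix_length_le h3 (prefix_merge u v) hl'.le, ?_⟩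
      · rintro rfl; exact lt_irrefl _ hl
      · rintro rfl; exact lt_irrefl _ hl'

end Overlaps

/-! ## Runs of the greedy algorithm -/

section Greedy

variable {β : Type}

theorem SubstringFree.ne_nil {P : Finset (List β)} (h : SubstringFree P) {u v : List β}
    (hu : u ∈ P) (hv : v ∈ P) (huv : u ≠ v) : u ≠ [] := by
  rintro rfl
  exact huv (h _ hu _ hv (List.nil_infix))

/-- Guarantees that inserting a concatenation never collides with a string already present, so the
multiset count in `val_insert_append` is exact. -/
theorem append_notMem {P : Finset (List β)} (hP : SubstringFree P) {u v : List β} (hu : u ∈ P)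
    (hv0 : v ≠ []) : u ++ v ∉ P := fun h => by
  have := hP _ hu _ h (List.prefix_append u v).isInfix
  simp at this
  exact hv0 this

variable [DecidableEq β]

theorem mem_insert_erase {P : Finset (List β)} {u v m x : List β} :
    x ∈ insert m ((P.erase u).erase v) ↔ x = m ∨ (x ≠ v ∧ x ≠ u ∧ x ∈ P) := by
  simp

theorem GreedyStep.substringFree {P Q : Finset (List β)} (h : GreedyStep P Q)
    (hP : SubstringFree P) : SubstringFree Q := by
  obtain ⟨u, hu, v, hv, huv, hmax, rfl⟩ := h
  have hu0 := hP.ne_nil hu hv huv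
  have hv0 := hP.ne_nil hv hu huv.symm
  intro x hx y hy hxy
  rw [mem_insert_erase] at hx hy
  rcases hx with rfl | ⟨hxv, hxu, hx⟩ <;> rcases hy with rfl | ⟨hyv, hyu, hy⟩
  · rfl
  · exact absurd (hP _ hu _ hy ((prefix_merge u v).isInfix.trans hxy)).symm hyu
  · rcases infix_of_infix_merge hu0 hv0 hxy with h | h | h | h
    · exact absurd (hP _ hx _ hu h) hxu
    · exact absurd (hP _ hx _ hv h) hxv
    · exact absurd (hP _ hu _ hx h).symm hxu
    -- The only place where the greedy choice matters: an overlap from `u` to `x` longer than `ov u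
    -- v` contradicts maximality.
    · exact absurd (hmax u hu x hx (Ne.symm hxu)) (not_le.2 h)
  · exact hP _ hx _ hy hxy

theorem GreedyStep.nil_notMem {P Q : Finset (List β)} (h : GreedyStep P Q)
    (hP : [] ∉ P) : [] ∉ Q := by
  obtain ⟨u, hu, v, hv, huv, hmax, rfl⟩ := h
  rw [mem_insert_erase]
  rintro (h | h)
  · have := prefix_merge u v
    rw [← h, List.prefix_nil] at this
    exact hP (this ▸ hu)
  · exact hP h.2.2

theorem GreedyStep.nonempty {P Q : Finset (List β)} (h : GreedyStep P Q) : Q.Nonempty := by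
  obtain ⟨u, hu, v, hv, huv, hmax, rfl⟩ := h
  exact Finset.insert_nonempty _ _

/-- Different strings of `P` have only the empty overlap. -/
def NonOverlapping (P : Finset (List β)) : Prop :=
  ∀ x ∈ P, ∀ y ∈ P, x ≠ y → ov x y = 0

theorem NonOverlapping.greedyStep {P Q : Finset (List β)} (hP : SubstringFree P)
    (h0 : NonOverlapping P) (h : GreedyStep P Q) : NonOverlapping Q := by
  obtain ⟨u, hu, v, hv, huv, hmax, rfl⟩ := h
  have hu0 := hP.ne_nil hu hv huv
  have hv0 := hP.ne_nil hv hu huv.symm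
  intro x hx y hy hxy
  rw [mem_insert_erase] at hx hy
  rcases hx with rfl | ⟨hxv, hxu, hx⟩ <;> rcases hy with rfl | ⟨hyv, hyu, hy⟩
  · exact absurd rfl hxy
  · have := ov_merge_left_le hu0 hv0 (fun h => hyv (hP _ hv _ hy h).symm)
    have := h0 v hv y hy (Ne.symm hyv)
    omega
  · have := ov_merge_right_le (v := v) (fun h => hxu (hP _ hu _ hx h).symm)
    have := h0 x hx u hu hxu
    omega
  · exact h0 x hx y hy hxy

/-- `w` is the concatenation of the strings of `P` in some order. -/
def IsConcatenation (P : Finset (List β)) (w : List β) : Prop :=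
  ∃ l : List (List β), (l : Multiset (List β)) = P.val ∧ w = l.flatten

theorem val_insert_append {P : Finset (List β)} (hP : SubstringFree P) {u v : List β} (hu : u ∈ P)
    (hv : v ∈ P) (huv : u ≠ v) :
    (insert (u ++ v) ((P.erase u).erase v)).val = (u ++ v) ::ₘ (P.val.erase u).erase v ∧
      P.val = u ::ₘ v ::ₘ (P.val.erase u).erase v := by
  constructor
  · rw [Finset.insert_val_of_notMem, Finset.erase_val, Finset.erase_val]
    intro h
    exact append_notMem hP hu (hP.ne_nil hv hu huv.symm)
      (Finset.mem_of_mem_erase (Finset.mem_of_mem_erase h))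
  · rw [Multiset.cons_erase, Multiset.cons_erase hu]
    rw [Multiset.mem_erase_of_ne huv.symm]
    exact hv

/-- Undo the run step by step: in a listing for the later set, the entry `u ++ v` is replaced by the
two entries `u`, `v`. -/
theorem isConcatenation_of_greedy {P : Finset (List β)} {w : List β} (hP : SubstringFree P)
    (h0 : NonOverlapping P) (h : IsGreedyLinear P w) : IsConcatenation P w := by
  unfold IsGreedyLinear at h
  induction h using Relation.ReflTransGen.head_induction_on with
  | refl => exact ⟨[w], rfl, by simp⟩
  | head hstep _ ih =>
    obtain ⟨l, hl, rfl⟩ := ih (hstep.substringFree hP) (h0.greedyStep hP hstep)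
    obtain ⟨u, hu, v, hv, huv, hmax, rfl⟩ := hstep
    rw [merge_of_ov_eq_zero (h0 u hu v hv huv)] at hl
    obtain ⟨e1, e2⟩ := val_insert_append hP hu hv huv
    rw [e1] at hl
    have hm : (u ++ v) ∈ l := by
      have : (u ++ v) ∈ (l : Multiset (List β)) := by rw [hl]; simp
      simpa using this
    obtain ⟨l₁, l₂, rfl⟩ := List.append_of_mem hm
    refine ⟨l₁ ++ u :: v :: l₂, ?_, by simp⟩
    rw [e2]
    have h3 : ((l₁ ++ (u ++ v) :: l₂ : List (List β)) : Multiset (List β))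
        = (u ++ v) ::ₘ (l₁ ++ l₂ : List (List β)) :=
      Multiset.coe_eq_coe.2 List.perm_middle
    rw [h3, Multiset.cons_inj_right] at hl
    rw [← hl]
    exact Multiset.coe_eq_coe.2
      (List.perm_middle.trans (List.Perm.cons _ List.perm_middle))

/-- When all overlaps are zero every pair is a maximal one, so the run may always merge the first
two strings of the prescribed listing. -/
theorem greedy_of_isConcatenation {P : Finset (List β)} {w : List β} (hP : SubstringFree P)
    (h0 : NonOverlapping P) (hne : P.Nonempty) (h : IsConcatenation P w) :
    IsGreedyLinear P w := by
  obtain ⟨l, hl, rfl⟩ := h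
  induction hn : l.length generalizing l P with
  | zero =>
    rw [List.length_eq_zero_iff] at hn
    subst hn
    rw [Multiset.coe_nil, eq_comm, Finset.val_eq_zero] at hl
    exact absurd hne (by simp [hl])
  | succ n ih =>
    match l, hn with
    | [x], _ =>
      have : P = {x} := Finset.val_injective (by rw [← hl]; rfl)
      subst this
      rw [List.flatten_singleton]
      exact Relation.ReflTransGen.refl
    | u :: v :: r, hn =>
      have hnd : (u :: v :: r).Nodup := by
        rw [← Multiset.coe_nodup, hl]; exact P.nodup
      have huv : u ≠ v := by rintro rfl; simp at hnd
      have hu : u ∈ P := by rw [← Finset.mem_val, ← hl]; simp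
      have hv : v ∈ P := by rw [← Finset.mem_val, ← hl]; simp
      have hov := h0 u hu v hv huv
      have hstep : GreedyStep P (insert (u ++ v) ((P.erase u).erase v)) :=
        ⟨u, hu, v, hv, huv, fun x hx y hy hxy => by rw [h0 x hx y hy hxy]; exact Nat.zero_le _,
          by rw [merge_of_ov_eq_zero hov]⟩
      obtain ⟨e1, e2⟩ := val_insert_append hP hu hv huv
      have := ih (hstep.substringFree hP) (h0.greedyStep hP hstep) hstep.nonempty
        ((u ++ v) :: r) (by
          rw [e1, ← hl, ← Multiset.cons_coe, ← Multiset.cons_coe, ← Multiset.cons_coe,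
            Multiset.erase_cons_head, Multiset.erase_cons_head]) (by simpa using hn)
      simp only [List.flatten_cons, List.append_assoc] at this ⊢
      exact Relation.ReflTransGen.head hstep this

/-- Only the last step counts, by `ov_merge_self_le`. At least one step is required, because a
single initial string may well overlap itself. -/
theorem ov_self_eq_zero_of_greedy {P : Finset (List β)} {w : List β} (hP : SubstringFree P)
    (h0 : NonOverlapping P) (h : IsGreedyLinear P w) (hne : P ≠ {w}) : ov w w = 0 := by
  unfold IsGreedyLinear at h
  induction h using Relation.ReflTransGen.head_induction_on with
  | refl => exact absurd rfl hne
  | @head P Q hstep _ ih =>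
    by_cases hQ : Q = {w}
    · obtain ⟨u, hu, v, hv, huv, hmax, rfl⟩ := hstep
      have : merge u v = w := by
        rw [← Finset.mem_singleton, ← hQ]; exact Finset.mem_insert_self _ _
      subst this
      have := ov_merge_self_le (hP.ne_nil hu hv huv) (hP.ne_nil hv hu huv.symm)
        (fun h => huv (hP _ hu _ hv h)) (fun h => huv (hP _ hv _ hu h).symm)
      rw [h0 v hv u hu huv.symm] at this
      omega
    · exact ih (hstep.substringFree hP) (h0.greedyStep hP hstep) hQ

end Greedy

/-! ## Strings over the doubled alphabet -/

section Doubled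

variable {α : Type}

/-- The unbarred letters of a string. -/
def leftPart (l : List (α ⊕ α)) : List α := l.filterMap Sum.getLeft?

/-- The barred letters of a string, without their bars. -/
def rightPart (l : List (α ⊕ α)) : List α := l.filterMap Sum.getRight?

@[simp] theorem leftPart_append (l m : List (α ⊕ α)) :
    leftPart (l ++ m) = leftPart l ++ leftPart m := List.filterMap_append

@[simp] theorem rightPart_append (l m : List (α ⊕ α)) :
    rightPart (l ++ m) = rightPart l ++ rightPart m := List.filterMap_append

@[simp] theorem leftPart_map_inl (l : List α) : leftPart (l.map Sum.inl) = l := by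
  induction l <;> simp_all [leftPart]

@[simp] theorem leftPart_map_inr (l : List α) : leftPart (l.map Sum.inr) = [] := by
  induction l <;> simp_all [leftPart]

@[simp] theorem rightPart_map_inl (l : List α) : rightPart (l.map Sum.inl) = [] := by
  induction l <;> simp_all [rightPart]

@[simp] theorem rightPart_map_inr (l : List α) : rightPart (l.map Sum.inr) = l := by
  induction l <;> simp_all [rightPart]

theorem length_leftPart_add_rightPart (l : List (α ⊕ α)) :
    (leftPart l).length + (rightPart l).length = l.length := by
  induction l with
  | nil => rfl
  | cons x l ih =>
    simp only [leftPart, rightPart] at ih ⊢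
    cases x <;> simp [List.filterMap_cons] <;> omega

theorem leftPart_flatten (L : List (List (α ⊕ α))) :
    leftPart L.flatten = (L.map leftPart).flatten := by
  induction L <;> simp_all [leftPart]

theorem rightPart_flatten (L : List (List (α ⊕ α))) :
    rightPart L.flatten = (L.map rightPart).flatten := by
  induction L <;> simp_all [rightPart]

theorem flatten_filter_ne_nil {β : Type} [DecidableEq β] (L : List (List β)) :
    (L.filter (· ≠ [])).flatten = L.flatten := by
  induction L with
  | nil => rfl
  | cons x L ih => by_cases h : x = [] <;> simp_all

/-- The string begins with an unbarred letter and ends with a barred one. -/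
def StartsAtBlock (u : List (α ⊕ α)) : Prop :=
  (∃ a t, u = Sum.inl a :: t) ∧ ∃ a t, u = t ++ [Sum.inr a]

theorem map_inl_injective : Function.Injective (List.map (Sum.inl : α → α ⊕ α)) :=
  List.map_injective_iff.2 Sum.inl_injective

theorem map_inr_injective : Function.Injective (List.map (Sum.inr : α → α ⊕ α)) :=
  List.map_injective_iff.2 Sum.inr_injective

theorem infix_of_map_infix_map {β γ : Type} {f : β → γ} (hf : Function.Injective f)
    {x y : List β} (h : x.map f <:+: y.map f) : x <:+: y := by
  obtain ⟨s, t, h⟩ := h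
  obtain ⟨p, q, rfl, h1, rfl⟩ := List.map_eq_append_iff.1 h.symm
  obtain ⟨p', q', rfl, rfl, h2⟩ := List.map_eq_append_iff.1 h1
  exact ⟨p', q, by rw [List.map_injective_iff.2 hf h2]⟩

theorem eq_nil_of_subset_inl_inr {s : List (α ⊕ α)} {x y : List α} (h1 : s ⊆ x.map Sum.inl)
    (h2 : s ⊆ y.map Sum.inr) : s = [] := by
  cases s with
  | nil => rfl
  | cons z s =>
    have h1 := h1 (List.mem_cons_self)
    have h2 := h2 (List.mem_cons_self)
    simp only [List.mem_map] at h1 h2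
    obtain ⟨a, -, rfl⟩ := h1
    obtain ⟨b, -, hb⟩ := h2
    exact absurd hb (by simp)

theorem ov_inl_inr (x y : List α) : ov (x.map Sum.inl) (y.map Sum.inr) = 0 :=
  Nat.le_zero.1 (ov_le fun s hs => by
    rw [eq_nil_of_subset_inl_inr hs.1.subset hs.2.2.1.subset]; rfl)

theorem ov_inr_inl (x y : List α) : ov (x.map Sum.inr) (y.map Sum.inl) = 0 :=
  Nat.le_zero.1 (ov_le fun s hs => by
    rw [eq_nil_of_subset_inl_inr hs.2.2.1.subset hs.1.subset]; rfl)

/-- A place where a barred letter is followed by an unbarred one must be a boundary between blocks,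
since each block is of one kind. -/
theorem exists_split_flatten {L : List (List (α ⊕ α))}
    (hL : ∀ t ∈ L, (∃ x : List α, t = x.map Sum.inl) ∨ ∃ x : List α, t = x.map Sum.inr)
    {p q : List (α ⊕ α)} {a b : α} (h : L.flatten = p ++ [Sum.inr a] ++ Sum.inl b :: q) :
    ∃ L₁ L₂, L = L₁ ++ L₂ ∧ L₁.flatten = p ++ [Sum.inr a] ∧ L₂.flatten = Sum.inl b :: q := by
  induction L generalizing p with
  | nil => simp at h
  | cons t L ih =>
    rw [List.flatten_cons, List.append_eq_append_iff] at h
    rcases h with ⟨x, hx, hx'⟩ | ⟨y, hy, hy'⟩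
    · rcases List.eq_nil_or_concat' x with rfl | ⟨x, c, rfl⟩
      · exact ⟨[t], L, rfl, by simpa using hx.symm, by simpa using hx'⟩
      · rw [← List.append_assoc] at hx
        obtain ⟨rfl, hc⟩ := List.append_inj' hx rfl
        simp only [List.cons.injEq, and_true] at hc
        subst hc
        obtain ⟨L₁, L₂, rfl, h1, h2⟩ :=
          ih (fun s hs => hL s (List.mem_cons_of_mem _ hs)) hx'
        exact ⟨t :: L₁, L₂, rfl, by simp [h1], h2⟩
    · cases y with
      | nil => exact ⟨[t], L, rfl, by simpa using hy, by simpa using hy'.symm⟩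
      | cons c y =>
        simp only [List.cons_append, List.cons.injEq] at hy'
        obtain ⟨rfl, -⟩ := hy'
        exfalso
        rcases hL t (List.mem_cons_self) with ⟨x, rfl⟩ | ⟨x, rfl⟩
        · have : Sum.inr a ∈ x.map (Sum.inl : α → α ⊕ α) := by rw [hy]; simp
          simp at this
        · have : Sum.inl b ∈ x.map (Sum.inr : α → α ⊕ α) := by rw [hy]; simp
          simp at this

variable [DecidableEq α]

/-- The strings of `A`, and the strings of `B` with bars. -/
def mixed (A B : Finset (List α)) : Finset (List (α ⊕ α)) :=
  A.image (List.map Sum.inl) ∪ B.image (List.map Sum.inr)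

theorem mem_mixed {A B : Finset (List α)} {x : List (α ⊕ α)} :
    x ∈ mixed A B ↔ (∃ a ∈ A, a.map Sum.inl = x) ∨ ∃ b ∈ B, b.map Sum.inr = x := by
  simp [mixed]

/-- The empty string is allowed here; a barred string inside an unbarred one (or conversely) must be
empty, and then `P` has no other string. -/
theorem substringFree_withBarred {P : Finset (List α)} (hP : SubstringFree P) :
    SubstringFree (withBarred P) := by
  have key : ∀ a ∈ P, ∀ b ∈ P, ∀ f g : α → α ⊕ α, (a.map f ⊆ b.map g → a.map f = []) →
      a.map f <:+: b.map g → a.map f = b.map g := by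
    intro a ha b hb f g hs h
    have h0 := hs h.subset
    rw [List.map_eq_nil_iff] at h0
    subst h0
    rw [← hP _ ha _ hb List.nil_infix]
    rfl
  intro x hx y hy hxy
  rcases mem_mixed.1 hx with ⟨a, ha, rfl⟩ | ⟨a, ha, rfl⟩ <;>
    rcases mem_mixed.1 hy with ⟨b, hb, rfl⟩ | ⟨b, hb, rfl⟩
  · rw [hP _ ha _ hb (infix_of_map_infix_map Sum.inl_injective hxy)]
  · exact key a ha b hb _ _ (fun h => eq_nil_of_subset_inl_inr (List.Subset.refl _) h) hxy
  · exact key a ha b hb _ _ (fun h => eq_nil_of_subset_inl_inr h (List.Subset.refl _)) hxy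
  · rw [hP _ ha _ hb (infix_of_map_infix_map Sum.inr_injective hxy)]

/-- What the strings of a greedy run satisfy that starts with a substring-free set of nonempty
strings. -/
structure IsProper (P : Finset (List α)) : Prop where
  substringFree : SubstringFree P
  nil_notMem : [] ∉ P
  nonempty : P.Nonempty

theorem IsProper.greedyStep {P Q : Finset (List α)} (hP : IsProper P) (h : GreedyStep P Q) :
    IsProper Q :=
  ⟨h.substringFree hP.substringFree, h.nil_notMem hP.nil_notMem, h.nonempty⟩

theorem IsProper.substringFree_mixed {A B : Finset (List α)} (hA : IsProper A) (hB : IsProper B) :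
    SubstringFree (mixed A B) := by
  intro x hx y hy hxy
  rcases mem_mixed.1 hx with ⟨a, ha, rfl⟩ | ⟨a, ha, rfl⟩ <;>
    rcases mem_mixed.1 hy with ⟨b, hb, rfl⟩ | ⟨b, hb, rfl⟩
  · rw [hA.1 _ ha _ hb (infix_of_map_infix_map Sum.inl_injective hxy)]
  · have := eq_nil_of_subset_inl_inr (List.Subset.refl _) hxy.subset
    exact absurd ha (List.map_eq_nil_iff.1 this ▸ hA.2)
  · have := eq_nil_of_subset_inl_inr hxy.subset (List.Subset.refl _)
    exact absurd ha (List.map_eq_nil_iff.1 this ▸ hB.2)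
  · rw [hB.1 _ ha _ hb (infix_of_map_infix_map Sum.inr_injective hxy)]

theorem inl_notMem_inr {A : Finset (List α)} (hA : [] ∉ A) {x : List α} :
    x.map Sum.inl ∉ A.image (List.map (Sum.inr : α → α ⊕ α)) := by
  simp only [Finset.mem_image, not_exists, not_and]
  intro a ha h
  have := eq_nil_of_subset_inl_inr (List.Subset.refl (x.map Sum.inl))
    (by rw [← h]; exact List.Subset.refl _)
  rw [this, List.map_eq_nil_iff] at h
  exact hA (h ▸ ha)

theorem inr_notMem_inl {A : Finset (List α)} (hA : [] ∉ A) {x : List α} :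
    x.map Sum.inr ∉ A.image (List.map (Sum.inl : α → α ⊕ α)) := by
  simp only [Finset.mem_image, not_exists, not_and]
  intro a ha h
  have := eq_nil_of_subset_inl_inr (List.Subset.refl (a.map Sum.inl))
    (by rw [h]; exact List.Subset.refl _)
  rw [List.map_eq_nil_iff] at this
  exact hA (this ▸ ha)

/-- The empty string would be its own barred copy; without it the two halves are disjoint. -/
theorem val_mixed {A B : Finset (List α)} (hA : [] ∉ A) :
    (mixed A B).val = A.val.map (List.map Sum.inl) + B.val.map (List.map Sum.inr) := by
  have hd : Disjoint (A.image (List.map (Sum.inl : α → α ⊕ α)))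
      (B.image (List.map Sum.inr)) := by
    rw [Finset.disjoint_right]
    intro x hx
    obtain ⟨b, -, rfl⟩ := Finset.mem_image.1 hx
    exact inr_notMem_inl hA
  rw [mixed, ← Finset.disjUnion_eq_union _ _ hd]
  change (A.image _).val + (B.image _).val = _
  rw [Finset.image_val_of_injOn map_inl_injective.injOn,
    Finset.image_val_of_injOn map_inr_injective.injOn]

theorem isConcatenation_leftPart {A B : Finset (List α)} (hA : [] ∉ A)
    {L : List (List (α ⊕ α))} (hL : (L : Multiset (List (α ⊕ α))) = (mixed A B).val) :
    IsConcatenation A (leftPart L.flatten) := by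
  -- Barred blocks have empty left part; filtering them out leaves exactly the strings of `A`, none
  -- of which is empty.
  refine ⟨(L.map leftPart).filter (· ≠ []), ?_, ?_⟩
  · rw [← Multiset.filter_coe, ← Multiset.map_coe, hL, val_mixed hA]
    simp only [Multiset.map_add, Multiset.map_map, Function.comp_def, leftPart_map_inl,
      leftPart_map_inr, Multiset.filter_add, Multiset.map_id']
    rw [Multiset.filter_eq_self.2, Multiset.filter_eq_nil.2, add_zero]
    · intro a ha
      obtain ⟨b, -, rfl⟩ := Multiset.mem_map.1 ha
      simp
    · rintro a ha
      simp only [ne_eq]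
      rintro rfl
      exact hA ha
  · rw [flatten_filter_ne_nil, leftPart_flatten]

theorem isConcatenation_rightPart {A B : Finset (List α)} (hA : [] ∉ A) (hB : [] ∉ B)
    {L : List (List (α ⊕ α))} (hL : (L : Multiset (List (α ⊕ α))) = (mixed A B).val) :
    IsConcatenation B (rightPart L.flatten) := by
  refine ⟨(L.map rightPart).filter (· ≠ []), ?_, ?_⟩
  · rw [← Multiset.filter_coe, ← Multiset.map_coe, hL, val_mixed hA]
    simp only [Multiset.map_add, Multiset.map_map, Function.comp_def, rightPart_map_inl,
      rightPart_map_inr, Multiset.filter_add, Multiset.map_id']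
    rw [Multiset.filter_eq_nil.2, Multiset.filter_eq_self.2, zero_add]
    · rintro a ha
      simp only [ne_eq]
      rintro rfl
      exact hB ha
    · intro a ha
      obtain ⟨b, -, rfl⟩ := Multiset.mem_map.1 ha
      simp
  · rw [flatten_filter_ne_nil, rightPart_flatten]

theorem exists_of_greedy_mixed {A B : Finset (List α)} {w : List (α ⊕ α)} (hA : IsProper A)
    (hB : IsProper B) (h : IsGreedyLinear (mixed A B) w) :
    ∃ A' B', Relation.ReflTransGen GreedyStep A A' ∧ Relation.ReflTransGen GreedyStep B B' ∧
      IsProper A' ∧ IsProper B' ∧ NonOverlapping A' ∧ NonOverlapping B' ∧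
      IsConcatenation (mixed A' B') w ∧ ov w w = 0 := by
  unfold IsGreedyLinear at h
  -- Both halves stay nonempty, so a set of the form `mixed A B` is never the end of a run: the
  -- phase of zero overlaps is always reached.
  have hne : ∀ A B : Finset (List α), IsProper A → IsProper B → mixed A B ≠ {w} := by
    intro A B hA hB h
    obtain ⟨a, ha⟩ := hA.3
    obtain ⟨b, hb⟩ := hB.3
    have h1 : a.map Sum.inl ∈ mixed A B := mem_mixed.2 (Or.inl ⟨a, ha, rfl⟩)
    have h2 : b.map Sum.inr ∈ mixed A B := mem_mixed.2 (Or.inr ⟨b, hb, rfl⟩)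
    rw [h, Finset.mem_singleton] at h1 h2
    exact inl_notMem_inr hB.2 (Finset.mem_image.2 ⟨b, hb, h2.trans h1.symm⟩)
  generalize hQ : mixed A B = Q at h
  induction h using Relation.ReflTransGen.head_induction_on generalizing A B with
  | refl => exact absurd hQ (hne A B hA hB)
  | head hstep htail ih =>
    subst hQ
    have hinl : ∀ {x}, x ∈ A → x.map Sum.inl ∈ mixed A B :=
      fun h => mem_mixed.2 (Or.inl ⟨_, h, rfl⟩)
    have hinr : ∀ {x}, x ∈ B → x.map Sum.inr ∈ mixed A B :=
      fun h => mem_mixed.2 (Or.inr ⟨_, h, rfl⟩)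
    obtain ⟨u, hu, v, hv, huv, hmax, rfl⟩ := id hstep
    by_cases h0 : ov u v = 0
    · have hQ0 : NonOverlapping (mixed A B) := fun x hx y hy hxy =>
        Nat.le_zero.1 (h0 ▸ hmax x hx y hy hxy)
      have hg : IsGreedyLinear (mixed A B) w := Relation.ReflTransGen.head hstep htail
      have hfree := hA.substringFree_mixed hB
      refine ⟨A, B, .refl, .refl, hA, hB, fun x hx y hy hxy => ?_, fun x hx y hy hxy => ?_,
        isConcatenation_of_greedy hfree hQ0 hg,
        ov_self_eq_zero_of_greedy hfree hQ0 hg (hne A B hA hB)⟩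
      · rw [← ov_map (Sum.inl_injective (β := α))]
        exact hQ0 _ (hinl hx) _ (hinl hy) (map_inl_injective.ne hxy)
      · rw [← ov_map (Sum.inr_injective (α := α))]
        exact hQ0 _ (hinr hx) _ (hinr hy) (map_inr_injective.ne hxy)
    · rcases mem_mixed.1 hu with ⟨a, ha, rfl⟩ | ⟨a, ha, rfl⟩ <;>
        rcases mem_mixed.1 hv with ⟨b, hb, rfl⟩ | ⟨b, hb, rfl⟩
      · have hs : GreedyStep A (insert (merge a b) ((A.erase a).erase b)) := by
          refine ⟨a, ha, b, hb, fun h => huv (h ▸ rfl), fun x hx y hy hxy => ?_, rfl⟩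
          rw [← ov_map (Sum.inl_injective (β := α)) x, ← ov_map (Sum.inl_injective (β := α)) a]
          exact hmax _ (hinl hx) _ (hinl hy) (map_inl_injective.ne hxy)
        obtain ⟨A', B', h1, h2, h3⟩ := ih (hA.greedyStep hs) hB (by
          -- A step on two unbarred strings leaves the barred half untouched, so the new set is
          -- again of the form `mixed`.
          rw [merge_map Sum.inl_injective, mixed, mixed, Finset.erase_union_distrib,
            Finset.erase_union_distrib, Finset.erase_eq_of_notMem (inl_notMem_inr hB.2),
            Finset.erase_eq_of_notMem (inl_notMem_inr hB.2), Finset.image_insert,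
            Finset.image_erase map_inl_injective, Finset.image_erase map_inl_injective,
            Finset.insert_union])
        exact ⟨A', B', .head hs h1, h2, h3⟩
      · exact absurd (ov_inl_inr a b) h0
      · exact absurd (ov_inr_inl a b) h0
      · have hs : GreedyStep B (insert (merge a b) ((B.erase a).erase b)) := by
          refine ⟨a, ha, b, hb, fun h => huv (h ▸ rfl), fun x hx y hy hxy => ?_, rfl⟩
          rw [← ov_map (Sum.inr_injective (α := α)) x, ← ov_map (Sum.inr_injective (α := α)) a]
          exact hmax _ (hinr hx) _ (hinr hy) (map_inr_injective.ne hxy)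
        obtain ⟨A', B', h1, h2, h3⟩ := ih hA (hB.greedyStep hs) (by
          rw [merge_map Sum.inr_injective, mixed, mixed, Finset.erase_union_distrib,
            Finset.erase_union_distrib, Finset.erase_eq_of_notMem (inr_notMem_inl hA.2),
            Finset.erase_eq_of_notMem (inr_notMem_inl hA.2), Finset.image_insert,
            Finset.image_erase map_inr_injective, Finset.image_erase map_inr_injective,
            Finset.union_insert])
        exact ⟨A', B', h1, .head hs h2, h3⟩

/-- Unless the rotation is trivial, the cut of `w` that yields `u` lies between a barred and an
unbarred letter, hence between two blocks; rotating `w` there just rotates the listing. -/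
theorem exists_listing_of_isRotated {A B : Finset (List α)} {u w : List (α ⊕ α)}
    (h : IsConcatenation (mixed A B) w) (hr : w ~r u) (hu : StartsAtBlock u) :
    ∃ L : List (List (α ⊕ α)), (L : Multiset (List (α ⊕ α))) = (mixed A B).val ∧
      u = L.flatten := by
  obtain ⟨L, hL, rfl⟩ := h
  obtain ⟨n, hn, rfl⟩ := List.isRotated_iff_mod.1 hr
  rw [List.rotate_eq_drop_append_take hn] at hu ⊢
  obtain ⟨⟨b, q, hq⟩, a, p, hp⟩ := hu
  have hw := (List.take_append_drop n L.flatten)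
  generalize List.take n L.flatten = x at *
  generalize List.drop n L.flatten = y at *
  rcases List.eq_nil_or_concat' x with rfl | ⟨x, c, rfl⟩
  · exact ⟨L, hL, by simpa using hw⟩
  cases y with
  | nil => exact ⟨L, hL, by simpa using hw⟩
  | cons d y =>
    rw [← List.append_assoc] at hp
    obtain ⟨-, hc⟩ := List.append_inj' hp rfl
    simp only [List.cons.injEq, and_true] at hc
    simp only [List.cons_append, List.cons.injEq] at hq
    rw [hc, hq.1] at hw ⊢
    have hL' : ∀ t ∈ L, (∃ x : List α, t = x.map Sum.inl) ∨ ∃ x : List α, t = x.map Sum.inr := by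
      intro t ht
      have : t ∈ mixed A B := by rw [← Finset.mem_val, ← hL]; exact ht
      rcases mem_mixed.1 this with ⟨x, -, h⟩ | ⟨x, -, h⟩
      · exact Or.inl ⟨x, h.symm⟩
      · exact Or.inr ⟨x, h.symm⟩
    obtain ⟨L₁, L₂, rfl, h1, h2⟩ := exists_split_flatten hL' hw.symm
    exact ⟨L₂ ++ L₁, by rw [← hL]; exact Multiset.coe_eq_coe.2 List.perm_append_comm,
      by rw [List.flatten_append, h1, h2]⟩

theorem greedy_parts {P : Finset (List α)} (hP : IsProper P) {c : Cycle (α ⊕ α)}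
    (h : IsGreedyCircular (withBarred P) c) {u : List (α ⊕ α)} (hc : c = u)
    (hu : StartsAtBlock u) :
    IsGreedyLinear P (leftPart u) ∧ IsGreedyLinear P (rightPart u) := by
  obtain ⟨w, hw, rfl⟩ := h
  obtain ⟨A, B, h1, h2, hA, hB, hA0, hB0, hcat, hov⟩ := exists_of_greedy_mixed hP hP hw
  rw [hov, List.drop_zero, Cycle.coe_eq_coe] at hc
  obtain ⟨L, hL, rfl⟩ := exists_listing_of_isRotated hcat hc hu
  exact ⟨h1.trans (greedy_of_isConcatenation hA.1 hA0 hA.3 (isConcatenation_leftPart hA.2 hL)),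
    h2.trans (greedy_of_isConcatenation hB.1 hB0 hB.3 (isConcatenation_rightPart hA.2 hB.2 hL))⟩

end Doubled

/-! ## The canonical rotation of a circular string -/

section Radix

variable {β : Type} (B : ℕ) (e : β → ℕ)

/-- The number with the digits `e x`, in base `B`. -/
def radix (l : List β) : ℕ := l.foldl (fun n x => B * n + e x) 0

theorem foldl_radix (n : ℕ) (l : List β) :
    l.foldl (fun n x => B * n + e x) n = n * B ^ l.length + radix B e l := by
  induction l generalizing n with
  | nil => simp [radix]
  | cons x l ih =>
    rw [radix, List.foldl_cons, List.foldl_cons, ih, ih (B * 0 + e x), List.length_cons]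
    ring

theorem radix_cons (x : β) (l : List β) :
    radix B e (x :: l) = e x * B ^ l.length + radix B e l := by
  rw [radix, List.foldl_cons, foldl_radix]; simp

theorem radix_concat (x : β) (l : List β) : radix B e (l ++ [x]) = B * radix B e l + e x := by
  simp [radix]

variable {B e}

theorem radix_lt (he : ∀ x, e x < B) (l : List β) : radix B e l < B ^ l.length := by
  induction l with
  | nil => simp [radix]
  | cons x l ih =>
    rw [radix_cons, List.length_cons, pow_succ]
    have := Nat.mul_le_mul_right (B ^ l.length) (he x)
    rw [Nat.succ_eq_add_one, add_mul, one_mul, mul_comm B] at this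
    omega

theorem mul_add_lt_mul_add {a b x y : ℕ} (hx : x < B) (h : a < b) : B * a + x < B * b + y := by
  have := Nat.mul_le_mul_left B h
  rw [Nat.succ_eq_add_one, mul_add, mul_one] at this
  omega

/-- Comparing numbers digit by digit from the leading end needs only the verdict so far, not the
numbers. This lets a finite automaton compare keys. -/
theorem compare_mul_add {x y : ℕ} (hx : x < B) (hy : y < B) (a b : ℕ) :
    compare (B * a + x) (B * b + y) = (compare a b).then (compare x y) := by
  rcases lt_trichotomy a b with h | rfl | h
  · rw [compare_lt_iff_lt.2 h, compare_lt_iff_lt.2 (mul_add_lt_mul_add hx h)]; rfl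
  · rw [compare_eq_iff_eq.2 (rfl : a = a)]
    rcases lt_trichotomy x y with h | rfl | h
    · rw [compare_lt_iff_lt.2 h, compare_lt_iff_lt.2 (by omega)]; rfl
    · rw [compare_eq_iff_eq.2 rfl, compare_eq_iff_eq.2 rfl]; rfl
    · rw [compare_gt_iff_gt.2 h, compare_gt_iff_gt.2 (by omega)]; rfl
  · rw [compare_gt_iff_gt.2 h, compare_gt_iff_gt.2 (mul_add_lt_mul_add hy h)]; rfl

theorem radix_injective (he : ∀ x, e x < B) (hinj : Function.Injective e) {l m : List β}
    (hlen : l.length = m.length) (h : radix B e l = radix B e m) : l = m := by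
  induction l using List.reverseRecOn generalizing m with
  | nil => exact (List.length_eq_zero_iff.1 hlen.symm).symm
  | append_singleton l x ih =>
    rcases List.eq_nil_or_concat' m with rfl | ⟨m, y, rfl⟩
    · simp at hlen
    rw [radix_concat, radix_concat, ← compare_eq_iff_eq, compare_mul_add (he x) (he y),
      Ordering.then_eq_eq, compare_eq_iff_eq, compare_eq_iff_eq] at h
    rw [hinj h.2, ih (by simpa using hlen) h.1]

end Radix

/-! ### Enumerating rotations and choosing a least one. -/

section Rotations

variable {β : Type}

/-- The rotation that moves the last letter to the front. -/
def rotateRight (l : List β) : List β :=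
  match l.reverse with
  | [] => []
  | x :: t => x :: t.reverse

@[simp] theorem rotateRight_nil : rotateRight ([] : List β) = [] := rfl

@[simp] theorem rotateRight_concat (l : List β) (x : β) : rotateRight (l ++ [x]) = x :: l := by
  simp [rotateRight]

@[simp] theorem length_rotateRight (l : List β) : (rotateRight l).length = l.length := by
  rcases List.eq_nil_or_concat' l with rfl | ⟨l, x, rfl⟩ <;> simp

theorem rotateRight_rotate_one (l : List β) : rotateRight (l.rotate 1) = l := by
  cases l <;> simp

theorem rotateRight_isRotated (l : List β) : rotateRight l ~r l := by
  rcases List.eq_nil_or_concat' l with rfl | ⟨l, x, rfl⟩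
  · exact List.IsRotated.refl _
  · exact ⟨1, by simp⟩

theorem iterate_rotateRight_rotate (l : List β) (n k : ℕ) :
    rotateRight^[k] (l.rotate (n + k)) = l.rotate n := by
  induction k with
  | zero => rfl
  | succ k ih =>
    rw [Function.iterate_succ_apply, ← Nat.add_assoc, ← List.rotate_rotate,
      rotateRight_rotate_one, ih]

theorem exists_iterate_rotateRight {l m : List β} (hl : l ≠ []) (h : l ~r m) :
    ∃ k < l.length, rotateRight^[k] l = m := by
  have hpos := List.length_pos_iff.2 hl
  obtain ⟨n, hn, rfl⟩ := List.isRotated_iff_mod.1 h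
  rcases Nat.eq_zero_or_pos n with rfl | hn0
  · exact ⟨0, hpos, by simp⟩
  · refine ⟨l.length - n, by omega, ?_⟩
    have := iterate_rotateRight_rotate l n (l.length - n)
    rwa [Nat.add_sub_cancel' hn, List.rotate_length] at this

variable {κ : Type} [LinearOrder κ] (key : List β → κ)

/-- The least one, with respect to `key`, of `b` and the first `m` strings in the sequence
`c`, `rotateRight c`, …. -/
def leastRotation : ℕ → List β → List β → List β
  | 0, _, b => b
  | m + 1, c, b => leastRotation m (rotateRight c) (if key c < key b then c else b)

theorem leastRotation_isRotated (m : ℕ) {c b : List β} (h : b ~r c) :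
    leastRotation key m c b ~r c := by
  induction m generalizing c b with
  | zero => exact h
  | succ m ih =>
    refine (ih ?_).trans (rotateRight_isRotated c)
    split_ifs
    · exact (rotateRight_isRotated c).symm
    · exact h.trans (rotateRight_isRotated c).symm

theorem key_leastRotation_le_right (m : ℕ) (c b : List β) :
    key (leastRotation key m c b) ≤ key b := by
  induction m generalizing c b with
  | zero => exact le_rfl
  | succ m ih =>
    refine (ih _ _).trans ?_
    split_ifs with h
    · exact h.le
    · exact le_rfl

theorem key_leastRotation_le (m : ℕ) (c b : List β) {k : ℕ} (hk : k < m) :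
    key (leastRotation key m c b) ≤ key (rotateRight^[k] c) := by
  induction m generalizing c b k with
  | zero => omega
  | succ m ih =>
    cases k with
    | zero =>
      refine (key_leastRotation_le_right key m _ _).trans ?_
      split_ifs with h
      · exact le_rfl
      · exact not_lt.1 h
    | succ k => exact ih _ _ (by omega)

/-- The rotation of `w` that has the least key. -/
def canonicalRotation (w : List β) : List β := leastRotation key w.length w w

theorem canonicalRotation_isRotated (w : List β) : canonicalRotation key w ~r w :=
  leastRotation_isRotated key _ (List.IsRotated.refl w)

theorem key_canonicalRotation_le {w v : List β} (h : w ~r v) :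
    key (canonicalRotation key w) ≤ key v := by
  by_cases hw : w = []
  · subst hw
    obtain rfl := List.isRotated_nil_iff'.1 h
    exact le_of_eq rfl
  obtain ⟨k, hk, rfl⟩ := exists_iterate_rotateRight hw h
  exact key_leastRotation_le key _ _ _ hk

/-- This makes `halve` well defined on circular strings: both sides have the minimal key of the same
rotation class, and keys separate strings of equal length. -/
theorem canonicalRotation_eq
    (hkey : ∀ l m : List β, l.length = m.length → key l = key m → l = m) {w v : List β}
    (h : w ~r v) : canonicalRotation key w = canonicalRotation key v := by
  have h1 := canonicalRotation_isRotated key w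
  have h2 := canonicalRotation_isRotated key v
  refine hkey _ _ (h1.trans (h.trans h2.symm)).perm.length_eq (le_antisymm ?_ ?_)
  · exact key_canonicalRotation_le key (h.trans h2.symm)
  · exact key_canonicalRotation_le key (h.symm.trans h1.symm)

end Rotations

/-! ### The key: bar pattern first, letters second. -/

section RotationKey

variable {α : Type} [Fintype α]

/-- `0` for an unbarred letter, `1` for a barred one. -/
def barDigit : α ⊕ α → ℕ
  | .inl _ => 0
  | .inr _ => 1

/-- A numbering of the letters. -/
noncomputable def letterDigit (x : α ⊕ α) : ℕ := Fintype.equivFin (α ⊕ α) x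

theorem letterDigit_lt (x : α ⊕ α) : letterDigit x < Fintype.card (α ⊕ α) :=
  (Fintype.equivFin (α ⊕ α) x).2

theorem letterDigit_injective : Function.Injective (letterDigit (α := α)) :=
  Fin.val_injective.comp (Fintype.equivFin (α ⊕ α)).injective

/-- Strings of the same length are compared by the positions of their bars first, and then
lexicographically. -/
noncomputable def rotationKey (l : List (α ⊕ α)) : ℕ ×ₗ ℕ :=
  toLex (radix 2 barDigit l, radix (Fintype.card (α ⊕ α)) letterDigit l)

theorem rotationKey_injective (l m : List (α ⊕ α)) (hlen : l.length = m.length)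
    (h : rotationKey l = rotationKey m) : l = m := by
  have := (Prod.mk.injEq _ _ _ _ ▸ toLex.injective h).2
  exact radix_injective letterDigit_lt letterDigit_injective hlen this

/-- One step of the finite automaton that compares the keys of two strings, which it reads in
parallel. -/
noncomputable def compareStep (v : Ordering × Ordering) (x y : α ⊕ α) : Ordering × Ordering :=
  (v.1.then (compare (barDigit x) (barDigit y)), v.2.then (compare (letterDigit x) (letterDigit y)))

/-- The state of the comparing automaton after it has read two strings. -/
noncomputable def compareFold : Ordering × Ordering → List (α ⊕ α) → List (α ⊕ α) →
    Ordering × Ordering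
  | v, x :: l, y :: m => compareFold (compareStep v x y) l m
  | v, _, _ => v

/-- Whether the comparing automaton found the first string to be the smaller one. -/
def isLess (v : Ordering × Ordering) : Bool := v.1.then v.2 == .lt

theorem barDigit_lt {α : Type} (x : α ⊕ α) : barDigit x < 2 := by
  cases x <;> simp [barDigit]

/-- The initial values `a`, `b`, `c`, `d` stand for the prefixes already read, which is what the
induction needs. -/
theorem compareFold_compare (a b c d : ℕ) {l m : List (α ⊕ α)} (h : l.length = m.length) :
    compareFold (compare a b, compare c d) l m =
      (compare (l.foldl (fun n x => 2 * n + barDigit x) a)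
        (m.foldl (fun n x => 2 * n + barDigit x) b),
      compare (l.foldl (fun n x => Fintype.card (α ⊕ α) * n + letterDigit x) c)
        (m.foldl (fun n x => Fintype.card (α ⊕ α) * n + letterDigit x) d)) := by
  induction l generalizing m a b c d with
  | nil => rw [← List.length_eq_zero_iff.1 h.symm]; cases m <;> simp_all [compareFold]
  | cons x l ih =>
    cases m with
    | nil => simp at h
    | cons y m =>
      rw [compareFold, compareStep, ← compare_mul_add (barDigit_lt x) (barDigit_lt y),
        ← compare_mul_add (letterDigit_lt x) (letterDigit_lt y), ih _ _ _ _ (by simpa using h)]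
      rfl

theorem isLess_compareFold {l m : List (α ⊕ α)} (h : l.length = m.length) :
    isLess (compareFold (.eq, .eq) l m) = decide (rotationKey l < rotationKey m) := by
  have := compareFold_compare 0 0 0 0 h
  rw [compare_eq_iff_eq.2 rfl] at this
  rw [this, isLess, Bool.eq_iff_iff, beq_iff_eq, decide_eq_true_eq, Ordering.then_eq_lt,
    compare_lt_iff_lt, compare_lt_iff_lt, compare_eq_iff_eq, rotationKey, rotationKey,
    Prod.Lex.toLex_lt_toLex]
  rfl

theorem radix_barDigit_eq_zero {α : Type} {l : List (α ⊕ α)} (h : radix 2 barDigit l = 0)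
    (b : α) : Sum.inr b ∉ l := by
  induction l with
  | nil => simp
  | cons x l ih =>
    rw [radix_cons, Nat.add_eq_zero_iff] at h
    cases x with
    | inl a => simpa using ih h.2
    | inr a => simp [barDigit] at h

theorem startsAtBlock_canonicalRotation {w : List (α ⊕ α)} {a b : α} (ha : Sum.inl a ∈ w)
    (hb : Sum.inr b ∈ w) : StartsAtBlock (canonicalRotation rotationKey w) := by
  have hmin : ∀ v, v ~r canonicalRotation rotationKey w →
      radix 2 barDigit (canonicalRotation rotationKey w) ≤ radix 2 barDigit v := by
    intro v hv
    have hv := hv.trans (canonicalRotation_isRotated rotationKey w)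
    have := key_canonicalRotation_le rotationKey hv.symm
    rcases Prod.Lex.toLex_le_toLex.1 this with h | h
    · exact h.le
    · exact h.1.le
  have hperm := (canonicalRotation_isRotated rotationKey w).perm
  rw [← hperm.mem_iff] at ha hb
  generalize canonicalRotation rotationKey w = u at *
  constructor
  · cases u with
    | nil => simp at ha
    | cons x t =>
      cases x with
      | inl c => exact ⟨c, t, rfl⟩
      | inr c =>
        obtain ⟨p, q, h⟩ := List.append_of_mem ha
        -- A leading barred letter has value `2 ^ t.length`, more than the whole value of a rotation
        -- that starts with an unbarred letter.
        have h1 := hmin (Sum.inl a :: q ++ p) (by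
          rw [h]; exact (List.isRotated_append (l := Sum.inl a :: q)))
        have h2 : (q ++ p).length = t.length := by
          have := congrArg List.length h
          simp only [List.length_cons, List.length_append] at this ⊢
          omega
        rw [List.cons_append, radix_cons, radix_cons, h2] at h1
        have h3 := radix_lt barDigit_lt (q ++ p)
        rw [h2] at h3
        simp only [barDigit] at h1
        omega
  · rcases List.eq_nil_or_concat' u with rfl | ⟨t, x, rfl⟩
    · simp at ha
    cases x with
    | inr c => exact ⟨c, t, rfl⟩
    | inl c =>
      -- Moving a final digit `0` to the front halves the value. Minimality then forces the value
      -- `0`, that is, no barred letter at all.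
      have h1 := hmin (Sum.inl c :: t) (by
        exact (List.isRotated_append (l := [Sum.inl c]) (l' := t)))
      rw [radix_cons, radix_concat] at h1
      simp only [barDigit] at h1
      have h2 := radix_barDigit_eq_zero (l := t) (by omega) b
      simp [h2] at hb

end RotationKey

/-! ## The back transformation -/

section Projection

variable {α : Type}

/-- The shorter one of the two parts of a string. -/
def shorterPart (u : List (α ⊕ α)) : List α :=
  if (leftPart u).length ≤ (rightPart u).length then leftPart u else rightPart u

theorem two_mul_length_shorterPart_le (u : List (α ⊕ α)) :
    2 * (shorterPart u).length ≤ u.length := by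
  have := length_leftPart_add_rightPart u
  rw [shorterPart]; split_ifs <;> omega

variable [Fintype α]

/-- The shorter part of a circular string over the doubled alphabet, read from its canonical
starting point. -/
noncomputable def halve (c : Cycle (α ⊕ α)) : List α :=
  Quotient.liftOn c (fun w => shorterPart (canonicalRotation rotationKey w)) fun _ _ h => by
    simp only [canonicalRotation_eq rotationKey rotationKey_injective h]

theorem halve_coe (w : List (α ⊕ α)) :
    halve (w : Cycle (α ⊕ α)) = shorterPart (canonicalRotation rotationKey w) := rfl

theorem two_mul_length_halve_le (c : Cycle (α ⊕ α)) : 2 * (halve c).length ≤ c.length := by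
  induction c using Quotient.inductionOn with
  | h w =>
    refine (two_mul_length_shorterPart_le _).trans_eq ?_
    exact (canonicalRotation_isRotated rotationKey w).perm.length_eq

end Projection

/-! ## Superstrings of the doubled instance -/

section Superstrings

theorem flatten_replicate_append_comm {β : Type} (a b : List β) (n : ℕ) :
    b ++ (List.replicate n (a ++ b)).flatten ++ a = (List.replicate (n + 1) (b ++ a)).flatten := by
  induction n with
  | zero => simp
  | succ n ih =>
    rw [List.replicate_succ, List.flatten_cons, List.replicate_succ, List.flatten_cons, ← ih]
    simp only [List.append_assoc]

/-- Any representative of a circular string may be used to find its substrings. -/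
theorem IsCircularSubstring.exists_infix {β : Type} {x u : List β}
    (h : IsCircularSubstring x (u : Cycle β)) :
    ∃ n : ℕ, x <:+: (List.replicate n u).flatten := by
  obtain ⟨w, hw, n, hn⟩ := h
  obtain ⟨k, hk, rfl⟩ := List.isRotated_iff_mod.1 (Cycle.coe_eq_coe.1 hw)
  rw [List.rotate_eq_drop_append_take hk]
  refine ⟨n + 1, ?_⟩
  -- With `w = ab` and `u = ba`, the power `wⁿ` lies inside `b(ab)ⁿa = uⁿ⁺¹`.
  rw [← flatten_replicate_append_comm]
  rw [List.take_append_drop]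
  exact hn.trans ⟨_, _, rfl⟩

variable {α : Type}

/-- An occurrence that crosses a seam would contain the last letter of a copy of `u`, which is
barred. -/
theorem StartsAtBlock.inl_infix {u : List (α ⊕ α)} (hu : StartsAtBlock u) {x : List α} {n : ℕ}
    (h : x.map Sum.inl <:+: (List.replicate n u).flatten) : x.map Sum.inl <:+: u := by
  induction n with
  | zero => exact (by simpa using h : x = []) ▸ List.nil_infix
  | succ n ih =>
    rw [List.replicate_succ, List.flatten_cons, List.infix_append_iff] at h
    rcases h with h | h | ⟨p, q, h, hp, hq⟩
    · exact h
    · exact ih h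
    · rcases List.eq_nil_or_concat' p with rfl | ⟨p, c, rfl⟩
      · exact ih (h ▸ hq.isInfix)
      · obtain ⟨-, a, t, rfl⟩ := hu
        obtain ⟨s, hs⟩ := hp
        rw [← List.append_assoc] at hs
        obtain ⟨-, hc⟩ := List.append_inj' hs rfl
        simp only [List.cons.injEq, and_true] at hc
        have : c ∈ x.map Sum.inl := by rw [h]; simp
        simp [hc] at this

/-- An occurrence that crosses a seam would contain the first letter of a copy of `u`, which is
unbarred. -/
theorem StartsAtBlock.inr_infix {u : List (α ⊕ α)} (hu : StartsAtBlock u) {x : List α} {n : ℕ}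
    (h : x.map Sum.inr <:+: (List.replicate n u).flatten) : x.map Sum.inr <:+: u := by
  induction n with
  | zero => exact (by simpa using h : x = []) ▸ List.nil_infix
  | succ n ih =>
    rw [List.replicate_succ, List.flatten_cons, List.infix_append_iff] at h
    rcases h with h | h | ⟨p, q, h, hp, hq⟩
    · exact h
    · exact ih h
    · cases q with
      | nil => rw [h, List.append_nil]; exact hp.isInfix
      | cons c q =>
        cases n with
        | zero => simp at hq
        | succ n =>
          obtain ⟨⟨a, t, rfl⟩, -⟩ := hu
          obtain ⟨s, hs⟩ := hq
          rw [List.replicate_succ, List.flatten_cons, List.cons_append, List.cons_append,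
            List.cons.injEq] at hs
          have : c ∈ x.map Sum.inr := by rw [h]; simp
          simp [hs.1] at this

theorem infix_leftPart {u : List (α ⊕ α)} {x : List α} (h : x.map Sum.inl <:+: u) :
    x <:+: leftPart u := by
  obtain ⟨s, t, rfl⟩ := h
  exact ⟨leftPart s, leftPart t, by simp⟩

theorem infix_rightPart {u : List (α ⊕ α)} {x : List α} (h : x.map Sum.inr <:+: u) :
    x <:+: rightPart u := by
  obtain ⟨s, t, rfl⟩ := h
  exact ⟨rightPart s, rightPart t, by simp⟩

variable [DecidableEq α]

theorem inl_mem_withBarred {P : Finset (List α)} {x : List α} (hx : x ∈ P) :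
    x.map Sum.inl ∈ withBarred P := mem_mixed.2 (Or.inl ⟨x, hx, rfl⟩)

theorem inr_mem_withBarred {P : Finset (List α)} {x : List α} (hx : x ∈ P) :
    x.map Sum.inr ∈ withBarred P := mem_mixed.2 (Or.inr ⟨x, hx, rfl⟩)

theorem startsAtBlock_of_isCircularSuperstring [Fintype α] {P : Finset (List α)}
    {w : List (α ⊕ α)} (h : IsCircularSuperstring (withBarred P) (w : Cycle (α ⊕ α)))
    {x : List α} (hx : x ∈ P) (hx0 : x ≠ []) :
    StartsAtBlock (canonicalRotation rotationKey w) := by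
  obtain ⟨a, ha⟩ := List.exists_mem_of_ne_nil x hx0
  obtain ⟨n, hn⟩ := (h _ (inl_mem_withBarred hx)).exists_infix
  obtain ⟨m, hm⟩ := (h _ (inr_mem_withBarred hx)).exists_infix
  obtain ⟨_, h1, h2⟩ := List.mem_flatten.1 (hn.subset (List.mem_map_of_mem ha))
  obtain ⟨_, h3, h4⟩ := List.mem_flatten.1 (hm.subset (List.mem_map_of_mem ha))
  rw [List.eq_of_mem_replicate h1] at h2
  rw [List.eq_of_mem_replicate h3] at h4
  exact startsAtBlock_canonicalRotation h2 h4

theorem isLinearSuperstring_halve [Fintype α] {P : Finset (List α)} {c : Cycle (α ⊕ α)}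
    (h : IsCircularSuperstring (withBarred P) c) : IsLinearSuperstring P (halve c) := by
  intro x hx
  by_cases hx0 : x = []
  · subst hx0; exact List.nil_infix
  induction c using Quotient.inductionOn with
  | h w =>
    change IsCircularSuperstring (withBarred P) (w : Cycle (α ⊕ α)) at h
    have hu := startsAtBlock_of_isCircularSuperstring h hx hx0
    have hc := Cycle.coe_eq_coe.2 (canonicalRotation_isRotated rotationKey w)
    rw [← hc] at h
    obtain ⟨n, hn⟩ := (h _ (inl_mem_withBarred hx)).exists_infix
    obtain ⟨m, hm⟩ := (h _ (inr_mem_withBarred hx)).exists_infix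
    change x <:+: shorterPart _
    rw [shorterPart]
    split_ifs
    · exact infix_leftPart (hu.inl_infix hn)
    · exact infix_rightPart (hu.inr_infix hm)

/-- A linear superstring followed by its barred copy is a circular superstring. -/
theorem isCircularSuperstring_double {P : Finset (List α)} {w : List α}
    (h : IsLinearSuperstring P w) :
    IsCircularSuperstring (withBarred P)
      ((w.map Sum.inl ++ w.map Sum.inr : List (α ⊕ α)) : Cycle (α ⊕ α)) := by
  intro x hx
  refine ⟨_, rfl, 1, ?_⟩
  rw [List.replicate_one, List.flatten_singleton]
  rcases mem_mixed.1 hx with ⟨a, ha, rfl⟩ | ⟨a, ha, rfl⟩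
  · exact ((h a ha).map Sum.inl).trans (List.prefix_append _ _).isInfix
  · exact ((h a ha).map Sum.inr).trans (List.suffix_append _ _).isInfix

/-- The two halves can share only the empty string, which contributes no length. -/
theorem totalLength_withBarred (P : Finset (List α)) :
    totalLength (withBarred P) = 2 * totalLength P := by
  have h1 : ∀ f : α → α ⊕ α, Function.Injective f →
      ∑ w ∈ P.image (List.map f), w.length = totalLength P := by
    intro f hf
    rw [Finset.sum_image (List.map_injective_iff.2 hf).injOn]
    simp [totalLength]
  have h2 := Finset.sum_union_inter (s₁ := P.image (List.map (Sum.inl : α → α ⊕ α)))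
    (s₂ := P.image (List.map Sum.inr)) (f := List.length)
  have h3 : ∑ w ∈ P.image (List.map (Sum.inl : α → α ⊕ α)) ∩ P.image (List.map Sum.inr),
      w.length = 0 := by
    refine Finset.sum_eq_zero fun w hw => ?_
    obtain ⟨h, h'⟩ := Finset.mem_inter.1 hw
    obtain ⟨a, -, rfl⟩ := Finset.mem_image.1 h
    obtain ⟨b, -, hb⟩ := Finset.mem_image.1 h'
    rw [eq_nil_of_subset_inl_inr (List.Subset.refl _) (by rw [hb]; exact List.Subset.refl _)]
    rfl
  rw [h1 _ Sum.inl_injective, h1 _ Sum.inr_injective, h3] at h2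
  rw [totalLength, withBarred]
  omega

theorem IsConcatenation.subset_of_mem {β : Type} {P : Finset (List β)} {w x : List β}
    (h : IsConcatenation P w) (hx : x ∈ P) : x ⊆ w := by
  obtain ⟨l, hl, rfl⟩ := h
  have : x ∈ l := by rw [← Finset.mem_val, ← hl] at hx; exact hx
  exact (List.sublist_flatten_of_mem this).subset

theorem isGreedyLinear_halve [Fintype α] {P : Finset (List α)} (hP : SubstringFree P)
    {c : Cycle (α ⊕ α)} (hc : IsGreedyCircular (withBarred P) c) :
    IsGreedyLinear P (halve c) := by
  obtain ⟨w, hw, rfl⟩ := id hc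
  rcases P.eq_empty_or_nonempty with rfl | hne
  · exfalso
    rcases Relation.ReflTransGen.cases_head hw with h | ⟨Q, ⟨u, hu, -⟩, -⟩
    · simp [withBarred] at h
    · simp [withBarred] at hu
  -- The empty string lies in every string, so it can only belong to `P` if `P = {[]}`; then
  -- `withBarred P` is also `{[]}`, and no step is possible.
  by_cases hnil : [] ∈ P
  · have hPe : P = {[]} := Finset.eq_singleton_iff_unique_mem.2
      ⟨hnil, fun x hx => (hP _ hnil _ hx List.nil_infix).symm⟩
    subst hPe
    have hw0 : w = [] := by
      rcases Relation.ReflTransGen.cases_head hw with h | ⟨Q, ⟨u, hu, v, hv, huv, -⟩, -⟩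
      · simpa [withBarred, eq_comm] using h
      · simp only [withBarred, Finset.image_singleton, List.map_nil, Finset.union_self,
          Finset.mem_singleton] at hu hv
        exact absurd (hu.trans hv.symm) huv
    subst hw0
    rw [List.drop_nil]
    exact Relation.ReflTransGen.refl
  have hPr : IsProper P := ⟨hP, hnil, hne⟩
  obtain ⟨A, B, -, -, hA, hB, -, -, hcat, hov⟩ := exists_of_greedy_mixed hPr hPr hw
  have hmem : ∀ {Q : Finset (List α)}, IsProper Q → ∃ x ∈ Q, ∃ a, a ∈ x := by
    intro Q hQ
    obtain ⟨x, hx⟩ := hQ.3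
    exact ⟨x, hx, List.exists_mem_of_ne_nil x fun h => hQ.2 (h ▸ hx)⟩
  obtain ⟨x, hx, a, ha⟩ := hmem hA
  obtain ⟨y, hy, b, hb⟩ := hmem hB
  have ha := hcat.subset_of_mem (mem_mixed.2 (Or.inl ⟨x, hx, rfl⟩)) (List.mem_map_of_mem ha)
  have hb := hcat.subset_of_mem (mem_mixed.2 (Or.inr ⟨y, hy, rfl⟩)) (List.mem_map_of_mem hb)
  have := greedy_parts hPr hc (u := canonicalRotation rotationKey w)
    (by rw [hov, List.drop_zero]
        exact (Cycle.coe_eq_coe.2 (canonicalRotation_isRotated rotationKey w)).symm)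
    (startsAtBlock_canonicalRotation ha hb)
  rw [hov, List.drop_zero, halve_coe, shorterPart]
  split_ifs
  · exact this.1
  · exact this.2

/-! ## Performance ratios -/

theorem performanceRatio_length_le {o c O C : ℤ} (ho : O = 2 * o) (hC : 2 * c ≤ C) (hoc : o ≤ c)
    (ho0 : 0 ≤ o) : performanceRatio o c ≤ performanceRatio O C := by
  by_cases h1 : C = O
  · rw [performanceRatio, if_pos (by omega), performanceRatio, if_pos h1]
  by_cases h2 : 0 < O ∧ 0 < C
  · have hone : (1 : ℝ) ≤ (C : ℝ) / O := by
      rw [one_le_div (by exact_mod_cast h2.1)]; exact_mod_cast (by omega : O ≤ C)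
    rw [performanceRatio, performanceRatio, if_neg h1, if_pos h2]
    split_ifs with h3 h4
    · rw [← ENNReal.ofReal_one]
      exact ENNReal.ofReal_le_ofReal (hone.trans (le_max_right _ _))
    · refine ENNReal.ofReal_le_ofReal ((max_le ?_ ?_).trans (le_max_right _ _))
      · refine le_trans ?_ hone
        rw [div_le_one (by exact_mod_cast h4.2)]; exact_mod_cast hoc
      · rw [div_le_div_iff₀ (by exact_mod_cast h4.1) (by exact_mod_cast h2.1)]
        have h5 : c * O ≤ C * o := by subst ho; nlinarith [h4.1]
        exact_mod_cast h5
    · omega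
  -- A circular solution that is not optimal and lacks positive costs has infinite ratio, so nothing
  -- is left to prove.
  · rw [performanceRatio.eq_def O, if_neg h1, if_neg h2]
    exact le_top

theorem performanceRatio_compression_le {o c O C : ℤ} (ho : O = 2 * o) (hC : C ≤ 2 * c)
    (hoc : c ≤ o) : performanceRatio o c ≤ performanceRatio O C := by
  by_cases h1 : C = O
  · rw [performanceRatio, if_pos (by omega), performanceRatio, if_pos h1]
  by_cases h2 : 0 < O ∧ 0 < C
  · have hone : (1 : ℝ) ≤ (O : ℝ) / C := by
      rw [one_le_div (by exact_mod_cast h2.2)]; exact_mod_cast (by omega : C ≤ O)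
    rw [performanceRatio, performanceRatio, if_neg h1, if_pos h2]
    split_ifs with h3 h4
    · rw [← ENNReal.ofReal_one]
      exact ENNReal.ofReal_le_ofReal (hone.trans (le_max_left _ _))
    · refine ENNReal.ofReal_le_ofReal ((max_le ?_ ?_).trans (le_max_left _ _))
      · rw [div_le_div_iff₀ (by exact_mod_cast h4.2) (by exact_mod_cast h2.2)]
        have h5 : o * C ≤ O * c := by subst ho; nlinarith [h4.1]
        exact_mod_cast h5
      · refine le_trans ?_ hone
        rw [div_le_one (by exact_mod_cast h4.1)]; exact_mod_cast hoc
    · omega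
  · rw [performanceRatio.eq_def O, if_neg h1, if_neg h2]
    exact le_top

/-- The chain `2|w| ≤ 2|g(c)| ≤ |c| ≤ |w w̄| = 2|w|` collapses. -/
theorem length_of_isOptimal [Fintype α] {P : Finset (List α)} {w : List α} {c : Cycle (α ⊕ α)}
    (hw : IsLinearSuperstring P w) (hc : IsCircularSuperstring (withBarred P) c)
    (hw' : ∀ z, IsLinearSuperstring P z → w.length ≤ z.length)
    (hc' : ∀ z, IsCircularSuperstring (withBarred P) z → c.length ≤ z.length) :
    c.length = 2 * w.length := by
  have h1 := hw' _ (isLinearSuperstring_halve hc)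
  have h2 := hc' _ (isCircularSuperstring_double hw)
  have h3 := two_mul_length_halve_le c
  rw [Cycle.length_coe, List.length_append, List.length_map, List.length_map] at h2
  omega

theorem SLS_isOptimal_iff {β : Type} [DecidableEq β] (m : Objective) {P : Finset (List β)}
    {w : List β} : (SLS β m).IsOptimal P w ↔
      IsLinearSuperstring P w ∧ ∀ z, IsLinearSuperstring P z → w.length ≤ z.length := by
  refine and_congr Iff.rfl (forall_congr' fun z => imp_congr Iff.rfl ?_)
  cases m
  · simp [SLS, objectiveCost, Objective.isMax]
  · simp only [SLS, objectiveCost, Objective.isMax, if_true]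
    omega

theorem SCS_isOptimal_iff {β : Type} [DecidableEq β] (m : Objective) {P : Finset (List β)}
    {w : Cycle β} : (SCS β m).IsOptimal P w ↔
      IsCircularSuperstring P w ∧ ∀ z, IsCircularSuperstring P z → w.length ≤ z.length := by
  refine and_congr Iff.rfl (forall_congr' fun z => imp_congr Iff.rfl ?_)
  cases m
  · simp [SCS, objectiveCost, Objective.isMax]
  · simp only [SCS, objectiveCost, Objective.isMax, if_true]
    omega

theorem performanceRatio_halve_le [Fintype α] (m : Objective) {P : Finset (List α)} {w : List α}
    {c y : Cycle (α ⊕ α)} (hy : IsCircularSuperstring (withBarred P) y)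
    (hw : (SLS α m).IsOptimal P w) (hc : (SCS (α ⊕ α) m).IsOptimal (withBarred P) c) :
    performanceRatio (objectiveCost m P w.length) (objectiveCost m P (halve y).length) ≤
      performanceRatio (objectiveCost m (withBarred P) c.length)
        (objectiveCost m (withBarred P) y.length) := by
  rw [SLS_isOptimal_iff] at hw
  rw [SCS_isOptimal_iff] at hc
  have h1 := length_of_isOptimal hw.1 hc.1 hw.2 hc.2
  have h2 := two_mul_length_halve_le y
  have h3 := hw.2 _ (isLinearSuperstring_halve hy)
  cases m with
  | length => refine performanceRatio_length_le ?_ ?_ ?_ ?_ <;> simp only [objectiveCost] <;> omega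
  | compression =>
    refine performanceRatio_compression_le ?_ ?_ ?_ <;>
      simp only [objectiveCost, totalLength_withBarred] <;> omega

end Superstrings

open Turing

/-! ## Turing machines -/

section Machines

/-- The transition function `f` leads from `a` to `b` in at most `n` steps. -/
def Within {C : Type} (f : C → Option C) (n : ℕ) (a b : C) : Prop :=
  ∃ k ≤ n, (flip bind f)^[k] (some a) = some b

theorem Within.refl {C : Type} (f : C → Option C) (a : C) : Within f 0 a a := ⟨0, le_rfl, rfl⟩

theorem Within.trans {C : Type} {f : C → Option C} {m n : ℕ} {a b c : C} (h : Within f m a b)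
    (h' : Within f n b c) : Within f (m + n) a c := by
  obtain ⟨k, hk, h⟩ := h
  obtain ⟨l, hl, h'⟩ := h'
  exact ⟨l + k, by omega, by rw [Function.iterate_add_apply, h, h']⟩

theorem Within.of_step {C : Type} {f : C → Option C} {a b : C} (h : f a = some b) :
    Within f 1 a b :=
  ⟨1, le_rfl, h⟩

theorem Within.head {C : Type} {f : C → Option C} {n : ℕ} {a b c : C} (h : f a = some b)
    (h' : Within f n b c) : Within f (n + 1) a c :=
  Nat.add_comm 1 n ▸ (Within.of_step h).trans h'

theorem Within.mono {C : Type} {f : C → Option C} {m n : ℕ} {a b : C} (h : Within f m a b)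
    (hmn : m ≤ n) : Within f n a b := by
  obtain ⟨k, hk, h⟩ := h
  exact ⟨k, hk.trans hmn, h⟩

/-- Checks a machine step stack by stack, so that each concrete step reduces to a case split and
`rfl`. -/
theorem step_eq {K Λ σ : Type} [DecidableEq K] {Γ : K → Type} {M : Λ → TM2.Stmt Γ Λ σ} {l : Λ}
    {v v' : σ} {S S' : ∀ k, List (Γ k)} {l' : Option Λ} (hl : (TM2.stepAux (M l) v S).l = l')
    (hv : (TM2.stepAux (M l) v S).var = v') (hS : ∀ k, (TM2.stepAux (M l) v S).stk k = S' k) :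
    TM2.step M ⟨some l, v, S⟩ = some ⟨l', v', S'⟩ := by
  subst hl hv
  rw [← funext hS]
  rfl

/-- A function is computable in polynomial time if there is a machine that turns every word `w`
into a word `H w` within polynomially many steps, where `H` maps codes to codes. -/
theorem polyTimeComputable_of_within {X Y : Type} (M : FinTM2) {ρ : List (M.Γ M.k₀) → X → Prop}
    {ρ' : List (M.Γ M.k₁) → Y → Prop} {h : X → Y} (H : List (M.Γ M.k₀) → List (M.Γ M.k₁))
    (time : Polynomial ℕ)
    (hM : ∀ w, Within M.step (time.eval w.length) (initList M w) (haltList M (H w)))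
    (hH : ∀ w x, ρ w x → ρ' (H w) (h x)) : PolyTimeComputable ρ ρ' h := by
  have hM' : ∀ w, Within M.step (time.eval w.length)
      (initList M (w.map (Equiv.refl (M.Γ M.k₀)).invFun))
      (haltList M ((H w).map (Equiv.refl (M.Γ M.k₁)).invFun)) := by
    intro w
    have h1 : w.map (Equiv.refl (M.Γ M.k₀)).invFun = w := List.map_id w
    have h2 : (H w).map (Equiv.refl (M.Γ M.k₁)).invFun = H w := List.map_id _
    rw [h1, h2]
    exact hM w
  exact ⟨fun w => H w.1, ⟨{
    tm := M
    inputAlphabet := Equiv.refl _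
    outputAlphabet := Equiv.refl _
    time := time
    outputsFun := fun w =>
      { steps := (hM' w.1).choose
        evals_in_steps := (hM' w.1).choose_spec.2
        steps_le_m := (hM' w.1).choose_spec.1 } }⟩, fun w x hx => hH w.1 x hx⟩

end Machines

/-! ### The machine that doubles an instance -/

section Doubling

variable {α : Type}

/-- The word without the end marks at the beginning (if the flag is set) and behind other end
marks, that is, without the codes of empty words. -/
def dropEmptyWords : Bool → List (Option α) → List (Option α)
  | _, [] => []
  | b, x :: l =>
    if (x.isNone && b) = true then dropEmptyWords b l else x :: dropEmptyWords x.isNone l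

/-- The code of `withBarred P`, computed from one of `P`. -/
def doubleCode (w : List (Option α)) : List (Option (α ⊕ α)) :=
  w.map (Option.map Sum.inl) ++ (dropEmptyWords true w).map (Option.map Sum.inr)

/-- The stacks of the doubling machine. -/
inductive DoubleStack
  | input
  | all
  | nonempty
  | output
  deriving DecidableEq

instance : Fintype DoubleStack where
  elems := {.input, .all, .nonempty, .output}
  complete x := by cases x <;> decide

/-- The labels of the doubling machine. -/
inductive DoubleLabel
  | scan
  | bar
  | copy
  deriving DecidableEq

instance : Fintype DoubleLabel where
  elems := {.scan, .bar, .copy}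
  complete x := by cases x <;> decide

/-- The stack alphabets of the doubling machine. -/
def DoubleSymbol (α : Type) : DoubleStack → Type
  | .output => Option (α ⊕ α)
  | _ => Option α

/-- The contents of the stacks of the doubling machine. -/
def doubleStk (i a f : List (Option α)) (o : List (Option (α ⊕ α))) :
    ∀ k, List (DoubleSymbol α k)
  | .input => i
  | .all => a
  | .nonempty => f
  | .output => o

/-- The states of the doubling machine: the symbol popped last, and whether a word begins. -/
abbrev DoubleState (α : Type) : Type := Option (Option α) × Bool

/-- The program of the doubling machine. -/
def doubleProgram : DoubleLabel → TM2.Stmt (DoubleSymbol α) DoubleLabel (DoubleState α)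
  | .scan =>
    .pop .input (fun s x => (x, s.2)) <|
    .branch (fun s => s.1.isSome)
      (.push .all (fun s => s.1.join) <|
        .branch (fun s => s.1.join.isNone && s.2) (.goto fun _ => .scan) <|
        .push .nonempty (fun s => s.1.join) <|
        .load (fun s => (s.1, s.1.join.isNone)) <| .goto fun _ => .scan)
      (.load (fun _ => (none, true)) <| .goto fun _ => .bar)
  -- The output is a stack, so the barred second half of the code is written first. Popping the
  -- reversed copies restores the original order.
  | .bar =>
    .pop .nonempty (fun s x => (x, s.2)) <|
    .branch (fun s => s.1.isSome)
      (.push .output (fun s => s.1.join.map Sum.inr) <| .goto fun _ => .bar)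
      (.load (fun _ => (none, true)) <| .goto fun _ => .copy)
  | .copy =>
    .pop .all (fun s x => (x, s.2)) <|
    .branch (fun s => s.1.isSome)
      (.push .output (fun s => s.1.join.map Sum.inl) <| .goto fun _ => .copy)
      (.load (fun _ => (none, true)) .halt)

/-- The doubling machine. -/
def doubleMachine (α : Type) [Fintype α] : FinTM2 where
  K := DoubleStack
  k₀ := .input
  k₁ := .output
  Γ := DoubleSymbol α
  Λ := DoubleLabel
  main := .scan
  σ := DoubleState α
  initialState := (none, true)
  Γk₀Fin := inferInstanceAs (Fintype (Option α))
  m := doubleProgram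

theorem doubleMachine_scan (i a f : List (Option α)) (s : DoubleState α) :
    Within (TM2.step doubleProgram) (i.length + 1)
      ⟨some .scan, s, doubleStk i a f []⟩
      ⟨some .bar, (none, true),
        doubleStk [] (i.reverse ++ a) ((dropEmptyWords s.2 i).reverse ++ f) []⟩ := by
  induction i generalizing a f s with
  | nil => exact Within.of_step (step_eq rfl rfl (by intro k; cases k <;> rfl))
  | cons x i ih =>
    rw [List.length_cons]
    obtain ⟨y, b⟩ := s
    rw [dropEmptyWords]
    split_ifs with h
    · refine Within.head (b := ⟨some .scan, (some x, b), doubleStk i (x :: a) f []⟩) ?_ ?_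
      · cases x <;> cases b <;> simp at h
        exact step_eq rfl rfl (by intro k; cases k <;> rfl)
      · simpa using ih (x :: a) f (some x, b)
    · refine Within.head
        (b := ⟨some .scan, (some x, x.isNone), doubleStk i (x :: a) (x :: f) []⟩) ?_ ?_
      · cases x <;> cases b <;> simp at h <;>
          exact step_eq rfl rfl (by intro k; cases k <;> rfl)
      · simpa using ih (x :: a) (x :: f) (some x, x.isNone)

theorem doubleMachine_bar (a f : List (Option α)) (o : List (Option (α ⊕ α)))
    (s : DoubleState α) :
    Within (TM2.step doubleProgram) (f.length + 1)
      ⟨some .bar, s, doubleStk [] a f o⟩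
      ⟨some .copy, (none, true), doubleStk [] a [] ((f.map (Option.map Sum.inr)).reverse ++ o)⟩ := by
  induction f generalizing o s with
  | nil => exact Within.of_step (step_eq rfl rfl (by intro k; cases k <;> rfl))
  | cons x f ih =>
    refine Within.head (b := ⟨some .bar, (some x, s.2), doubleStk [] a f (x.map Sum.inr :: o)⟩)
      (step_eq rfl rfl (by intro k; cases k <;> rfl)) ?_
    simpa using ih (x.map Sum.inr :: o) (some x, s.2)

theorem doubleMachine_copy (a : List (Option α)) (o : List (Option (α ⊕ α)))
    (s : DoubleState α) :
    Within (TM2.step doubleProgram) (a.length + 1)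
      ⟨some .copy, s, doubleStk [] a [] o⟩
      ⟨none, (none, true), doubleStk [] [] [] ((a.map (Option.map Sum.inl)).reverse ++ o)⟩ := by
  induction a generalizing o s with
  | nil => exact Within.of_step (step_eq rfl rfl (by intro k; cases k <;> rfl))
  | cons x a ih =>
    refine Within.head (b := ⟨some .copy, (some x, s.2), doubleStk [] a [] (x.map Sum.inl :: o)⟩)
      (step_eq rfl rfl (by intro k; cases k <;> rfl)) ?_
    simpa using ih (x.map Sum.inl :: o) (some x, s.2)

theorem length_dropEmptyWords_le (b : Bool) (w : List (Option α)) :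
    (dropEmptyWords b w).length ≤ w.length := by
  induction w generalizing b with
  | nil => exact le_rfl
  | cons x w ih =>
    rw [dropEmptyWords]
    split_ifs
    · exact (ih b).trans (Nat.le_succ _)
    · exact Nat.succ_le_succ (ih _)

theorem doubleMachine_within [Fintype α] (w : List (Option α)) :
    Within (doubleMachine α).step (3 * w.length + 3)
      (initList (doubleMachine α) w) (haltList (doubleMachine α) (doubleCode w)) := by
  have h1 : initList (doubleMachine α) w = ⟨some .scan, (none, true), doubleStk w [] [] []⟩ := by
    refine (TM2.Cfg.mk.injEq ..).mpr ⟨rfl, rfl, ?_⟩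
    funext k; cases k <;> rfl
  have h2 : haltList (doubleMachine α) (doubleCode w) =
      ⟨none, (none, true), doubleStk [] [] [] (doubleCode w)⟩ := by
    refine (TM2.Cfg.mk.injEq ..).mpr ⟨rfl, rfl, ?_⟩
    funext k; cases k <;> rfl
  rw [h1, h2]
  have h3 := (doubleMachine_scan w [] [] (none, true)).trans
    ((doubleMachine_bar _ _ [] _).trans (doubleMachine_copy _ _ _))
  simp only [List.append_nil, List.map_reverse, List.reverse_reverse, List.length_reverse] at h3
  refine Within.mono h3 ?_
  have := length_dropEmptyWords_le true w
  omega

theorem dropEmptyWords_map_some (b : Bool) (x : List α) (hx : x ≠ []) (m : List (Option α)) :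
    dropEmptyWords b (x.map some ++ m) = x.map some ++ dropEmptyWords false m := by
  induction x generalizing b with
  | nil => exact absurd rfl hx
  | cons a x ih =>
    cases x with
    | nil => simp [dropEmptyWords]
    | cons c x =>
      rw [List.map_cons, List.cons_append, dropEmptyWords]
      simp only [Option.isNone_some, Bool.false_and, Bool.false_eq_true, if_false]
      rw [ih _ (by simp)]; rfl

theorem dropEmptyWords_encodeWords [DecidableEq α] (l : List (List α)) :
    dropEmptyWords true (encodeWords l) = encodeWords (l.filter (· ≠ [])) := by
  induction l with
  | nil => rfl
  | cons x l ih =>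
    rw [encodeWords, List.flatMap_cons, ← encodeWords]
    by_cases hx : x = []
    · subst hx
      simpa [dropEmptyWords] using ih
    · rw [List.append_assoc, dropEmptyWords_map_some _ _ hx, List.filter_cons_of_pos (by simpa)]
      simpa [dropEmptyWords, encodeWords] using ih

theorem encodeWords_map {β γ : Type} (f : β → γ) (l : List (List β)) :
    (encodeWords l).map (Option.map f) = encodeWords (l.map (List.map f)) := by
  induction l with
  | nil => rfl
  | cons x l ih => simp [encodeWords, List.map_flatMap, List.flatMap_map, Function.comp_def]

/-- The empty word equals its barred copy, and a code lists no word twice; hence `dropEmptyWords` in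
the barred half. -/
theorem codesSet_doubleCode [DecidableEq α] {w : List (Option α)} {P : Finset (List α)}
    (h : CodesSet w P) : CodesSet (doubleCode w) (withBarred P) := by
  obtain ⟨l, hl, rfl⟩ := h
  refine ⟨l.map (List.map Sum.inl) ++ (l.filter (· ≠ [])).map (List.map Sum.inr), ?_, ?_⟩
  · have hnd : l.Nodup := by rw [← Multiset.coe_nodup, hl]; exact P.nodup
    have hmem : ∀ x, x ∈ l ↔ x ∈ P := fun x => by rw [← Finset.mem_val, ← hl]; rfl
    refine (Multiset.Nodup.ext ?_ (withBarred P).nodup).2 fun x => ?_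
    · rw [Multiset.coe_nodup, List.nodup_append]
      refine ⟨hnd.map map_inl_injective, (hnd.filter _).map map_inr_injective, ?_⟩
      rintro _ hx _ hy rfl
      obtain ⟨a, -, rfl⟩ := List.mem_map.1 hx
      obtain ⟨b, hb, h⟩ := List.mem_map.1 hy
      have := eq_nil_of_subset_inl_inr (s := b.map Sum.inr) (x := a)
        (by rw [h]; exact List.Subset.refl _) (List.Subset.refl _)
      rw [List.map_eq_nil_iff] at this
      simp [this] at hb
    · rw [Finset.mem_val, Multiset.mem_coe, List.mem_append, List.mem_map, List.mem_map]
      refine Iff.trans ?_ mem_mixed.symm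
      simp only [List.mem_filter, hmem, ne_eq, decide_eq_true_eq]
      constructor
      · rintro (⟨a, ha, rfl⟩ | ⟨a, ⟨ha, -⟩, rfl⟩)
        · exact Or.inl ⟨a, ha, rfl⟩
        · exact Or.inr ⟨a, ha, rfl⟩
      · rintro (⟨a, ha, rfl⟩ | ⟨a, ha, rfl⟩)
        · exact Or.inl ⟨a, ha, rfl⟩
        · by_cases h0 : a = []
          · exact Or.inl ⟨a, ha, by simp [h0]⟩
          · exact Or.inr ⟨a, ⟨ha, by simpa using h0⟩, rfl⟩
  · rw [doubleCode, dropEmptyWords_encodeWords, encodeWords_map, encodeWords_map, encodeWords,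
      encodeWords, encodeWords, List.flatMap_append]

theorem polyTimeComputable_withBarred [Fintype α] [DecidableEq α]
    {ρ : List (Option α) → Finset (List α) → Prop} (hρ : ∀ w P, ρ w P → CodesSet w P) :
    PolyTimeComputable ρ CodesSet (withBarred (α := α)) := by
  refine polyTimeComputable_of_within (doubleMachine α) (doubleCode (α := α))
    (3 * Polynomial.X + 3) (fun w => ?_) (fun w P h => codesSet_doubleCode (hρ w P h))
  refine (doubleMachine_within w).mono (le_of_eq ?_)
  simp only [Polynomial.eval_add, Polynomial.eval_mul, Polynomial.eval_ofNat, Polynomial.eval_X]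
  rfl

end Doubling

/-! ### The machine that halves a circular string -/

section Halving

/-- Zipping truncates to the shorter list, so projecting onto that component recovers it in full.
The machine thus finds the shorter part by pairing letters until one stack is empty. -/
theorem map_zip_eq_shorterPart {α : Type} (u : List (α ⊕ α)) :
    ((leftPart u).zip (rightPart u)).map
      (fun x => if decide ((rightPart u).length < (leftPart u).length) then x.2 else x.1) =
    shorterPart u := by
  rw [shorterPart]
  rcases le_or_gt (leftPart u).length (rightPart u).length with h | h
  · rw [if_pos h, decide_eq_false (not_lt.2 h)]
    exact List.map_fst_zip h
  · rw [if_neg (not_le.2 h), decide_eq_true h]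
    exact List.map_snd_zip h.le

/-- The stacks of the halving machine. -/
inductive HalveStack
  | cur
  | best
  | curRev
  | bestRev
  | count
  | left
  | right
  | pairs
  | output
  deriving DecidableEq

instance : Fintype HalveStack where
  elems := {.cur, .best, .curRev, .bestRev, .count, .left, .right, .pairs, .output}
  complete x := by cases x <;> decide

/-- The labels of the halving machine. -/
inductive HalveLabel
  | start
  | test
  | restore
  | compare
  | split
  | pair
  | clean
  | emit
  deriving DecidableEq

instance : Fintype HalveLabel where
  elems := {.start, .test, .restore, .compare, .split, .pair, .clean, .emit}
  complete x := by cases x <;> decide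

/-- The stack alphabets of the halving machine. -/
def HalveSymbol (α : Type) : HalveStack → Type
  | .cur | .best | .curRev | .bestRev => α ⊕ α
  | .count => Unit
  | .pairs => α × α
  | .left | .right | .output => α

variable {α : Type}

/-- The contents of the stacks of the halving machine. -/
def halveStk (c b c' b' : List (α ⊕ α)) (n : List Unit) (l r : List α) (p : List (α × α))
    (o : List α) : ∀ k, List (HalveSymbol α k)
  | .cur => c
  | .best => b
  | .curRev => c'
  | .bestRev => b'
  | .count => n
  | .left => l
  | .right => r
  | .pairs => p
  | .output => o

/-- The states of the halving machine. -/
@[ext] structure HalveState (α : Type) where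
  /-- the letter popped last from the first one of two stacks -/
  fst : Option (α ⊕ α) := none
  /-- the letter popped last from the second one of two stacks -/
  snd : Option (α ⊕ α) := none
  /-- the letter that is to be moved to the front -/
  held : Option (α ⊕ α) := none
  /-- the state of the comparing automaton -/
  verdict : Ordering × Ordering := (.eq, .eq)
  /-- a flag -/
  flag : Bool := false

noncomputable instance [Fintype α] : Fintype (HalveState α) :=
  Fintype.ofInjective (fun s => (s.fst, s.snd, s.held, s.verdict, s.flag)) fun s t h => by
    simp only [Prod.mk.injEq] at h
    exact HalveState.ext h.1 h.2.1 h.2.2.1 h.2.2.2.1 h.2.2.2.2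

variable [Fintype α] [Inhabited α]

/-- The letter in a register of the machine, with or without a bar. -/
def letterOf (x : Option (α ⊕ α)) : α ⊕ α := x.getD (.inl default)

/-- The letter in a register of the machine, without its bar. -/
def unbarred (x : Option (α ⊕ α)) : α := Sum.elim id id (letterOf x)

/-- The program of the halving machine. It runs through all rotations of its input, which it keeps
on the stack `cur`, with the least rotation so far on the stack `best`. -/
noncomputable def halveProgram :
    HalveLabel → TM2.Stmt (HalveSymbol α) HalveLabel (HalveState α)
  | .start =>
    .pop .cur (fun s x => { s with fst := x }) <|
    .branch (fun s => s.fst.isSome)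
      (.push .curRev (fun s => letterOf s.fst) <|
        .push .bestRev (fun s => letterOf s.fst) <|
        .push .count (fun _ => ()) <| .goto fun _ => .start)
      (.load (fun _ => {}) <| .goto fun _ => .test)
  | .test =>
    .pop .count (fun s x => { s with flag := Option.isSome x }) <|
    .branch (fun s => s.flag)
      (.load (fun s => { verdict := s.verdict }) <| .goto fun _ => .restore)
      (.load (fun _ => {}) <| .goto fun _ => .split)
  -- The letter popped first, the last one of the current string, is held back and pushed last,
  -- which performs `rotateRight`. Meanwhile `best` is refilled from whichever string won the last
  -- comparison.
  | .restore =>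
    .pop .curRev (fun s x => { s with fst := x }) <|
    .branch (fun s => s.fst.isSome)
      (.pop .bestRev (fun s x => { s with snd := x }) <|
        .push .best (fun s => letterOf (if isLess s.verdict then s.fst else s.snd)) <|
        .branch (fun s => s.held.isSome)
          (.push .cur (fun s => letterOf s.fst) <| .goto fun _ => .restore)
          (.load (fun s => { s with held := s.fst }) <| .goto fun _ => .restore))
      (.branch (fun s => s.held.isSome)
        (.push .cur (fun s => letterOf s.held) <|
          .load (fun _ => {}) <| .goto fun _ => .compare)
        (.load (fun _ => {}) <| .goto fun _ => .compare))
  | .compare =>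
    .pop .cur (fun s x => { s with fst := x }) <|
    .branch (fun s => s.fst.isSome)
      (.pop .best (fun s x => { s with snd := x }) <|
        .push .curRev (fun s => letterOf s.fst) <|
        .push .bestRev (fun s => letterOf s.snd) <|
        .load (fun s => { verdict := compareStep s.verdict (letterOf s.fst) (letterOf s.snd) }) <|
        .goto fun _ => .compare)
      (.load (fun s => { verdict := s.verdict }) <| .goto fun _ => .test)
  | .split =>
    .pop .bestRev (fun s x => { s with fst := x }) <|
    .branch (fun s => s.fst.isSome)
      -- Only empties `curRev`: in the halting configuration every stack but the output is empty.
      (.pop .curRev (fun s _ => s) <|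
        .branch (fun s => (letterOf s.fst).isLeft)
          (.push .left (fun s => unbarred (α := α) s.fst) <| .goto fun _ => .split)
          (.push .right (fun s => unbarred (α := α) s.fst) <| .goto fun _ => .split))
      (.load (fun _ => {}) <| .goto fun _ => .pair)
  | .pair =>
    .pop .left (fun s x => { s with fst := Option.map Sum.inl x }) <|
    .pop .right (fun s x => { s with snd := Option.map Sum.inl x }) <|
    .branch (fun s => s.fst.isSome && s.snd.isSome)
      (.push .pairs (fun s => (unbarred (α := α) s.fst, unbarred (α := α) s.snd)) <|
        .load (fun _ => {}) <| .goto fun _ => .pair)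
      (.load (fun s => { flag := s.fst.isSome }) <| .goto fun _ => .clean)
  | .clean =>
    .pop .left (fun s x => { s with fst := Option.map Sum.inl x }) <|
    .pop .right (fun s x => { s with snd := Option.map Sum.inl x }) <|
    .branch (fun s => s.fst.isSome || s.snd.isSome)
      (.load (fun s => { flag := s.flag }) <| .goto fun _ => .clean)
      (.load (fun s => { flag := s.flag }) <| .goto fun _ => .emit)
  | .emit =>
    .pop .pairs (fun s x => { s with
      fst := Option.map (fun p => Sum.inl (Prod.fst p)) x,
      snd := Option.map (fun p => Sum.inl (Prod.snd p)) x }) <|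
    .branch (fun s => s.fst.isSome)
      (.push .output (fun s => unbarred (α := α) (if s.flag then s.snd else s.fst)) <|
        .load (fun s => { flag := s.flag }) <| .goto fun _ => .emit)
      (.load (fun _ => {}) .halt)

/-- The halving machine. -/
noncomputable def halveMachine (α : Type) [Fintype α] [Inhabited α] : FinTM2 where
  K := HalveStack
  k₀ := .cur
  k₁ := .output
  Γ := HalveSymbol α
  Λ := HalveLabel
  main := .start
  σ := HalveState α
  initialState := {}
  Γk₀Fin := inferInstanceAs (Fintype (α ⊕ α))
  m := halveProgram

theorem halveMachine_start (c c' b' : List (α ⊕ α)) (n : List Unit) (s : HalveState α) :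
    Within (TM2.step halveProgram) (c.length + 1)
      ⟨some .start, s, halveStk c [] c' b' n [] [] [] []⟩
      ⟨some .test, {}, halveStk [] [] (c.reverse ++ c') (c.reverse ++ b')
        (List.replicate c.length () ++ n) [] [] [] []⟩ := by
  induction c generalizing c' b' n s with
  | nil => exact Within.of_step (step_eq rfl rfl (by intro k; cases k <;> rfl))
  | cons x c ih =>
    refine Within.head (b := ⟨some .start, { s with fst := some x },
      halveStk c [] (x :: c') (x :: b') (() :: n) [] [] [] []⟩)
      (step_eq rfl rfl (by intro k; cases k <;> rfl)) ?_
    have := ih (x :: c') (x :: b') (() :: n) { s with fst := some x }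
    rw [List.append_cons (List.replicate c.length ()), ← List.replicate_succ'] at this
    simpa using this

theorem halveMachine_compare (c b c' b' : List (α ⊕ α)) (h : c.length = b.length) (n : List Unit)
    (s : HalveState α) :
    Within (TM2.step halveProgram) (c.length + 1)
      ⟨some .compare, s, halveStk c b c' b' n [] [] [] []⟩
      ⟨some .test, { verdict := compareFold s.verdict c b },
        halveStk [] [] (c.reverse ++ c') (b.reverse ++ b') n [] [] [] []⟩ := by
  induction c generalizing b c' b' s with
  | nil =>
    rw [List.length_eq_zero_iff.1 h.symm]
    exact Within.of_step (step_eq rfl rfl (by intro k; cases k <;> rfl))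
  | cons x c ih =>
    cases b with
    | nil => simp at h
    | cons y b =>
      refine Within.head (b := ⟨some .compare, { verdict := compareStep s.verdict x y },
        halveStk c b (x :: c') (y :: b') n [] [] [] []⟩)
        (step_eq rfl rfl (by intro k; cases k <;> rfl)) ?_
      simpa [compareFold] using ih b (x :: c') (y :: b') (by simpa using h)
        { verdict := compareStep s.verdict x y }

theorem halveMachine_restore_held (c b c' b' : List (α ⊕ α)) (h : c'.length = b'.length)
    (n : List Unit) (s : HalveState α) (a : α ⊕ α) (hs : s.held = some a) :
    Within (TM2.step halveProgram) (c'.length + 1)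
      ⟨some .restore, s, halveStk c b c' b' n [] [] [] []⟩
      ⟨some .compare, {}, halveStk (a :: (c'.reverse ++ c))
        ((if isLess s.verdict then c' else b').reverse ++ b) [] [] n [] [] [] []⟩ := by
  obtain ⟨x₀, y₀, _, v, fl⟩ := s
  subst hs
  induction c' generalizing c b b' x₀ y₀ with
  | nil =>
    rw [List.length_eq_zero_iff.1 h.symm]
    refine Within.of_step (step_eq rfl rfl ?_)
    intro k; cases k <;> cases isLess v <;> rfl
  | cons x c' ih =>
    cases b' with
    | nil => simp at h
    | cons y b' =>
      refine Within.head (b := ⟨some .restore, ⟨some x, some y, some a, v, fl⟩,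
        halveStk (x :: c) (letterOf (if isLess v then some x else some y) :: b) c' b' n [] [] [] []⟩)
        (step_eq rfl rfl (by intro k; cases k <;> rfl)) ?_
      have := ih (x :: c) (letterOf (if isLess v then some x else some y) :: b) b' (by simpa using h) (some x) (some y)
      cases hv : isLess v <;> simpa [hv, letterOf] using this

theorem halveMachine_restore (c b : List (α ⊕ α)) (h : c.length = b.length)
    (n : List Unit) (v : Ordering × Ordering) :
    Within (TM2.step halveProgram) (c.length + 1)
      ⟨some .restore, { verdict := v }, halveStk [] [] c.reverse b.reverse n [] [] [] []⟩
      ⟨some .compare, {}, halveStk (rotateRight c)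
        (if isLess v then c else b) [] [] n [] [] [] []⟩ := by
  rcases List.eq_nil_or_concat' c with rfl | ⟨c, x, rfl⟩
  · rw [List.length_eq_zero_iff.1 h.symm, ite_self]
    exact Within.of_step (step_eq rfl rfl (by intro k; cases k <;> rfl))
  rcases List.eq_nil_or_concat' b with rfl | ⟨b, y, rfl⟩
  · simp at h
  rw [List.reverse_concat, List.reverse_concat, rotateRight_concat, List.length_append]
  refine Within.head (b := ⟨some .restore, ⟨some x, some y, some x, v, false⟩,
    halveStk [] [letterOf (if isLess v then some x else some y)] c.reverse b.reverse n [] [] [] []⟩)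
    (step_eq rfl rfl (by intro k; cases k <;> rfl)) ?_
  have := halveMachine_restore_held [] [letterOf (if isLess v then some x else some y)] c.reverse b.reverse
    (by simpa using h) n ⟨some x, some y, some x, v, false⟩ x rfl
  cases hv : isLess v <;> simpa [hv, letterOf] using this

/-- Loop invariant: at `test`, the verdict compares the current rotation with the best one. A round
takes `1` step for the test and at most `c.length + 1` for each of `restore` and `compare`. -/
theorem halveMachine_search (m : ℕ) (c b : List (α ⊕ α)) (h : b.length = c.length)
    (v : Ordering × Ordering) (hv : isLess v = decide (rotationKey c < rotationKey b)) :
    ∃ c' : List (α ⊕ α), c'.length = c.length ∧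
    Within (TM2.step halveProgram) (m * (2 * c.length + 3) + 1)
      ⟨some .test, { verdict := v },
        halveStk [] [] c.reverse b.reverse (List.replicate m ()) [] [] [] []⟩
      ⟨some .split, {}, halveStk [] [] c'
        (leastRotation rotationKey m c b).reverse [] [] [] [] []⟩ := by
  induction m generalizing c b v with
  | zero =>
    exact ⟨c.reverse, by simp, Within.mono (Within.of_step
      (step_eq rfl rfl (by intro k; cases k <;> rfl))) (by omega)⟩
  | succ m ih =>
    have hb : (if isLess v then c else b) = if rotationKey c < rotationKey b then c else b := by
      rw [hv]; simp
    have hlen : (rotateRight c).length = (if isLess v then c else b).length := by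
      rw [length_rotateRight]; split_ifs
      · rfl
      · exact h.symm
    obtain ⟨c', hc', hw⟩ := ih (rotateRight c) (if isLess v then c else b) hlen.symm _
      (isLess_compareFold hlen)
    refine ⟨c', by rw [hc', length_rotateRight], ?_⟩
    rw [leastRotation, ← hb]
    have h1 : Within (TM2.step halveProgram) 1
        ⟨some .test, { verdict := v },
          halveStk [] [] c.reverse b.reverse (List.replicate (m + 1) ()) [] [] [] []⟩
        ⟨some .restore, { verdict := v },
          halveStk [] [] c.reverse b.reverse (List.replicate m ()) [] [] [] []⟩ :=
      Within.of_step (step_eq rfl rfl (by intro k; cases k <;> rfl))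
    have h2 := halveMachine_restore c b h.symm (List.replicate m ()) v
    have h3 := halveMachine_compare _ _ [] [] hlen (List.replicate m ()) {}
    rw [List.append_nil, List.append_nil] at h3
    refine (h1.trans (h2.trans (h3.trans hw))).mono ?_
    rw [length_rotateRight, add_mul]
    omega

theorem halveMachine_split (c' b' : List (α ⊕ α)) (h : c'.length = b'.length) (l r : List α)
    (s : HalveState α) :
    Within (TM2.step halveProgram) (b'.length + 1)
      ⟨some .split, s, halveStk [] [] c' b' [] l r [] []⟩
      ⟨some .pair, {}, halveStk [] [] [] [] [] (leftPart b'.reverse ++ l)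
        (rightPart b'.reverse ++ r) [] []⟩ := by
  induction b' generalizing c' l r s with
  | nil =>
    rw [List.length_eq_zero_iff.1 h]
    exact Within.of_step (step_eq rfl rfl (by intro k; cases k <;> rfl))
  | cons x b' ih =>
    cases c' with
    | nil => simp at h
    | cons y c' =>
      cases x with
      | inl a =>
        refine Within.head (b := ⟨some .split, { s with fst := some (.inl a) },
          halveStk [] [] c' b' [] (a :: l) r [] []⟩)
          (step_eq rfl rfl (by intro k; cases k <;> rfl)) ?_
        have := ih c' (by simpa using h) (a :: l) r { s with fst := some (.inl a) }
        simpa [leftPart, rightPart, List.filterMap_cons] using this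
      | inr a =>
        refine Within.head (b := ⟨some .split, { s with fst := some (.inr a) },
          halveStk [] [] c' b' [] l (a :: r) [] []⟩)
          (step_eq rfl rfl (by intro k; cases k <;> rfl)) ?_
        have := ih c' (by simpa using h) l (a :: r) { s with fst := some (.inr a) }
        simpa [leftPart, rightPart, List.filterMap_cons] using this

/-- The last round may pop an unmatched letter, hence the unspecified remainders. The flag records
whether that letter came from `left`, that is, whether the right part is strictly shorter. -/
theorem halveMachine_pair (l r : List α) (p : List (α × α)) :
    ∃ l' r' : List α, l'.length ≤ l.length ∧ r'.length ≤ r.length ∧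
    Within (TM2.step halveProgram) (l.length + 1)
      ⟨some .pair, {}, halveStk [] [] [] [] [] l r p []⟩
      ⟨some .clean, { flag := decide (r.length < l.length) },
        halveStk [] [] [] [] [] l' r' ((l.zip r).reverse ++ p) []⟩ := by
  induction l generalizing r p with
  | nil =>
    refine ⟨[], r.tail, le_rfl, by simp, Within.of_step (step_eq ?_ ?_ ?_)⟩
    · rfl
    · rfl
    · intro k; cases k <;> rfl
  | cons x l ih =>
    cases r with
    | nil =>
      refine ⟨l, [], by simp, le_rfl, Within.mono (Within.of_step (step_eq ?_ ?_ ?_))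
        (Nat.le_add_left _ _)⟩
      · rfl
      · simp only [List.length_nil, List.length_cons, Nat.zero_lt_succ, decide_true]
        rfl
      · intro k; cases k <;> rfl
    | cons y r =>
      obtain ⟨l', r', hl, hr, h⟩ := ih r ((x, y) :: p)
      refine ⟨l', r', hl.trans (by simp), hr.trans (by simp), Within.head
        (b := ⟨some .pair, {}, halveStk [] [] [] [] [] l r ((x, y) :: p) []⟩)
        (step_eq rfl rfl (by intro k; cases k <;> rfl)) ?_⟩
      simpa using h

theorem halveMachine_clean (n : ℕ) (l r : List α) (hl : l.length ≤ n) (hr : r.length ≤ n)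
    (p : List (α × α)) (f : Bool) :
    Within (TM2.step halveProgram) (n + 1)
      ⟨some .clean, { flag := f }, halveStk [] [] [] [] [] l r p []⟩
      ⟨some .emit, { flag := f }, halveStk [] [] [] [] [] [] [] p []⟩ := by
  induction n generalizing l r with
  | zero =>
    rw [List.length_eq_zero_iff.1 (Nat.le_zero.1 hl), List.length_eq_zero_iff.1 (Nat.le_zero.1 hr)]
    exact Within.of_step (step_eq rfl rfl (by intro k; cases k <;> rfl))
  | succ n ih =>
    by_cases h : l = [] ∧ r = []
    · obtain ⟨rfl, rfl⟩ := h
      exact Within.mono (Within.of_step (step_eq rfl rfl (by intro k; cases k <;> rfl)))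
        (Nat.le_add_left _ _)
    · have h1 := ih l.tail r.tail (by simp; omega) (by simp; omega)
      refine Within.head ?_ h1
      cases l <;> cases r <;> first
        | exact absurd ⟨rfl, rfl⟩ h
        | exact step_eq rfl rfl (by intro k; cases k <;> rfl)

theorem halveMachine_emit (p : List (α × α)) (o : List α) (f : Bool) :
    Within (TM2.step halveProgram) (p.length + 1)
      ⟨some .emit, { flag := f }, halveStk [] [] [] [] [] [] [] p o⟩
      ⟨none, {}, halveStk [] [] [] [] [] [] [] []
        ((p.map fun x => if f then x.2 else x.1).reverse ++ o)⟩ := by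
  induction p generalizing o with
  | nil => exact Within.of_step (step_eq rfl rfl (by intro k; cases k <;> rfl))
  | cons x p ih =>
    refine Within.head (b := ⟨some .emit, { flag := f },
      halveStk [] [] [] [] [] [] [] p ((if f then x.2 else x.1) :: o)⟩)
      (step_eq rfl rfl (by intro k; cases f <;> cases k <;> rfl)) ?_
    simpa using ih ((if f then x.2 else x.1) :: o)

theorem halveMachine_within (w : List (α ⊕ α)) :
    Within (halveMachine α).step (2 * w.length ^ 2 + 8 * w.length + 6)
      (initList (halveMachine α) w)
      (haltList (halveMachine α) (shorterPart (α := α) (canonicalRotation rotationKey w))) := by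
  have h1 : initList (halveMachine α) w =
      ⟨some .start, {}, halveStk w [] [] [] [] [] [] [] []⟩ := by
    refine (TM2.Cfg.mk.injEq ..).mpr ⟨rfl, rfl, ?_⟩
    funext k; cases k <;> rfl
  have h2 : haltList (halveMachine α) (shorterPart (α := α) (canonicalRotation rotationKey w)) =
      ⟨none, {}, halveStk [] [] [] [] [] [] [] []
        (shorterPart (α := α) (canonicalRotation rotationKey w))⟩ := by
    refine (TM2.Cfg.mk.injEq ..).mpr ⟨rfl, rfl, ?_⟩
    funext k; cases k <;> rfl
  rw [h1, h2]
  have hstart := halveMachine_start w [] [] [] {}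
  simp only [List.append_nil] at hstart
  -- At the start both strings are `w`, and the initial verdict "equal" is correct.
  obtain ⟨c, hc, hsearch⟩ := halveMachine_search w.length w w rfl (.eq, .eq)
    (by rw [decide_eq_false (lt_irrefl _)]; rfl)
  rw [← canonicalRotation] at hsearch
  have hu : (canonicalRotation rotationKey w).length = w.length :=
    (canonicalRotation_isRotated rotationKey w).perm.length_eq
  generalize canonicalRotation rotationKey w = u at *
  have hsplit := halveMachine_split c u.reverse (by rw [hc, List.length_reverse, hu]) [] [] {}
  simp only [List.append_nil, List.reverse_reverse, List.length_reverse] at hsplit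
  obtain ⟨l, r, hl, hr, hpair⟩ := halveMachine_pair (leftPart u) (rightPart u) []
  rw [List.append_nil] at hpair
  have hsum := length_leftPart_add_rightPart u
  have hclean := halveMachine_clean w.length l r (by omega) (by omega)
    ((leftPart u).zip (rightPart u)).reverse (decide ((rightPart u).length < (leftPart u).length))
  have hemit := halveMachine_emit ((leftPart u).zip (rightPart u)).reverse []
    (decide ((rightPart u).length < (leftPart u).length))
  rw [List.append_nil, List.map_reverse, List.reverse_reverse, map_zip_eq_shorterPart] at hemit
  refine (hstart.trans (hsearch.trans (hsplit.trans (hpair.trans (hclean.trans hemit))))).mono ?_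
  rw [List.length_reverse, List.length_zip, mul_add]
  have : w.length * (2 * w.length) = 2 * w.length ^ 2 := by ring
  omega

end Halving

/-! ### The empty alphabet, where the registers of the halving machine have no default letter. -/

section EmptyAlphabet

/-- A machine that halts at once. -/
def haltMachine (Γ : Bool → Type) [Fintype (Γ true)] : FinTM2 where
  K := Bool
  k₀ := true
  k₁ := false
  Γ := Γ
  Λ := Unit
  main := ()
  σ := Unit
  initialState := ()
  m _ := .halt

theorem haltMachine_within (Γ : Bool → Type) [Fintype (Γ true)] :
    Within (haltMachine Γ).step 1 (initList (haltMachine Γ) []) (haltList (haltMachine Γ) []) := by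
  refine Within.of_step (step_eq rfl rfl ?_)
  intro k; cases k <;> rfl

end EmptyAlphabet

theorem polyTimeComputable_halve {α : Type} [Fintype α] :
    PolyTimeComputable CodesCircular CodesString (halve (α := α)) := by
  rcases isEmpty_or_nonempty α with hα | ⟨⟨a⟩⟩
  · have : Fintype (cond true (α ⊕ α) α) := inferInstanceAs (Fintype (α ⊕ α))
    have hnil : ∀ w : List (α ⊕ α), w = [] := fun w => List.eq_nil_iff_forall_not_mem.2 fun a =>
      (IsEmpty.false a).elim
    refine polyTimeComputable_of_within (haltMachine fun b => cond b (α ⊕ α) α)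
      (fun _ => []) 1 (fun w => ?_) (fun w c _ => ?_)
    · obtain rfl : w = [] := hnil w
      simpa using haltMachine_within fun b => cond b (α ⊕ α) α
    · exact (List.eq_nil_iff_forall_not_mem.2 fun a => (hα.false a).elim).symm
  · have : Inhabited α := ⟨a⟩
    refine polyTimeComputable_of_within (halveMachine α)
      (fun w => shorterPart (α := α) (canonicalRotation rotationKey w))
      (2 * Polynomial.X ^ 2 + 8 * Polynomial.X + 6) (fun w => ?_) (fun w c h => ?_)
    · refine (halveMachine_within w).mono (le_of_eq ?_)
      simp only [Polynomial.eval_add, Polynomial.eval_mul, Polynomial.eval_ofNat,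
        Polynomial.eval_X, Polynomial.eval_pow]
      rfl
    · subst h; rfl

/-! ### Assembling the reductions. -/

theorem isStrictReduction_halve (α : Type) [Fintype α] [DecidableEq α] (m : Objective) :
    IsStrictReduction (SLS α m) (SCS (α ⊕ α) m) withBarred (halve (α := α)) where
  polyTime_f := polyTimeComputable_withBarred fun _ _ h => h.1
  polyTime_g := polyTimeComputable_halve (α := α)
  instances _ _ := trivial
  solutions _ _ _ h := isLinearSuperstring_halve (α := α) h
  ratio _ _ _ hy _ hw _ hc := performanceRatio_halve_le m hy hw hc

theorem isGreedyReduction_halve (α : Type) [Fintype α] [DecidableEq α] (m : Objective) :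
    IsGreedyReduction ((SLS α m).restrict SubstringFree)
      ((SCS (α ⊕ α) m).restrict SubstringFree) withBarred (halve (α := α)) where
  polyTime_f := polyTimeComputable_withBarred fun _ _ h => h.1
  polyTime_g := polyTimeComputable_halve (α := α)
  instances _ h := ⟨trivial, substringFree_withBarred h.2⟩
  solutions _ _ _ h := isLinearSuperstring_halve (α := α) h
  ratio _ _ _ hy _ hw _ hc := performanceRatio_halve_le m hy hw hc
  greedy _ h _ hy := isGreedyLinear_halve h.2 hy

end CircularSuperstring

theorem theorem1 (α : Type) [Fintype α] [DecidableEq α] :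
    ∃ g : Cycle (α ⊕ α) → List α,
      (∀ m : Objective,
        IsStrictReduction (SLS α m) (SCS (α ⊕ α) m) withBarred g ∧
        IsGreedyReduction ((SLS α m).restrict SubstringFree)
          ((SCS (α ⊕ α) m).restrict SubstringFree) withBarred g) ∧
      (∀ (P : Finset (List α)) (w : List α) (c : Cycle (α ⊕ α)),
        (SLS α .length).IsOptimal P w → (SCS (α ⊕ α) .length).IsOptimal (withBarred P) c →
          c.length = 2 * w.length) ∧
      (∀ (P : Finset (List α)) (c : Cycle (α ⊕ α)),
        IsCircularSuperstring (withBarred P) c → 2 * (g c).length ≤ c.length) := by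
  refine ⟨halve, fun m => ⟨isStrictReduction_halve α m, isGreedyReduction_halve α m⟩,
    fun P w c hw hc => ?_, fun P c _ => two_mul_length_halve_le c⟩
  rw [SLS_isOptimal_iff] at hw
  rw [SCS_isOptimal_iff] at hc
  exact length_of_isOptimal hw.1 hc.1 hw.2 hc.2
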